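/- Call a normalized pure three-qubit state of parties $A,B,C$ a W-class state with parameters $\vec x=(x_A,x_B,x_C)$ (where $x_K\ge 0$ and $x_A+x_B+x_C\le 1$) if it is locally unitarily equivalent to $$\sqrt{x_0}\,|000\rangle+\sqrt{x_A}\,|100\rangle+\sqrt{x_B}\,|010\rangle+\sqrt{x_C}\,|001\rangle,\qquad x_0=1-x_A-x_B-x_C .$$ Fix a party $\star\in\{A,B,C\}$, write $\{n_1,n_2\}=\{A,B,C\}\setminus\{\star\}$ with $x_{n_1}\ge x_{n_2}$, and put $$\mathcal C(\vec x)=\begin{cases}2\sqrt{x_\star x_{n_1}}+\frac23\,x_{n_2}\sqrt{\dfrac{x_\star}{x_{n_1}}}&\text{if }x_{n_1}\neq0,\\[1ex]0&\text{otherwise.}\end{cases}$$ A quantum instrument is a countable family of completely positive maps $(\mathcal E_j)_j$ whose sum is trace-preserving. It is one-way local with respect to a party $K$ if each $\mathcal E_j$ is the tensor product of a completely positive map on $K$ and of trace-preserving completely positive maps on the two other parties. A finite-round LOCC instrument arises from a one-way local one, followed by coarse-graining, by finitely many further rounds, in each of which a one-way local instrument that depends on the previous outcome (as may the party) is applied,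 followed by coarse-graining; an instrument obtained by one such further round is said to be linked to the one before. $\mathrm{LOCC}$ is the set of instruments that are limits, for the sum over the outcomes of the diamond-norm distances, of coarse-grainings of the members of a sequence of finite-round LOCC instruments, each linked to the preceding one. **Lemma.** Let $\psi$ be a W-class state with parameters $\vec x$. 1. ($\mathcal C$ is non-increasing on average under LOCC.) Let $(\mathcal E_j)_j\in\mathrm{LOCC}$ map $\psi$ to pure states, that is, $\mathcal E_j(|\psi\rangle\langle\psi|)=p_j\,|\phi_j\rangle\langle\phi_j|$ with $p_j\ge0$ and unit vectors $\phi_j$. Then $\phi_j$ is a W-class state whenever $p_j\neq0$, and for all parameters $\vec x_j$ of these states $\sum_j p_j\,\mathcal C(\vec x_j)$ converges and $$\sum_j p_j\,\mathcal C(\vec x_j)\le\mathcal C(\vec x).$$ 2. (Strict decrease.) Suppose $\mathcal C(\vec x)>0$, and let party $\star$ or party $n_1$ (either of the two other parties if $x_{n_1}=x_{n_2}$) perform on $\psi$ a non-trivial measurement: countably many Kraus operators $M_j$ on its qubit with $\sum_jM_j^\dagger M_j=I$, not all of which are scalar multiples of unitaries. If outcome $j$ has probability $p_j$ and leaves the pure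 state $\phi_j$, then $\phi_j$ is a W-class state whenever $p_j\neq0$, and for all parameters $\vec x_j$ of these states $\sum_j p_j\,\mathcal C(\vec x_j)$ converges and $$\sum_j p_j\,\mathcal C(\vec x_j)<\mathcal C(\vec x).$$ -/

import Mathlib

open Filter Topology

noncomputable section

/-! ## Superoperators and quantum instruments -/

/-- Linear maps on the operators of a system with computational basis `S`. -/
abbrev SuperOp (S : Type) : Type := Matrix S S ℂ →ₗ[ℂ] Matrix S S ℂ

/-- A family of superoperators indexed by the classical outcomes `Θ`. -/
abbrev OpFamily (S Θ : Type) : Type := Θ → SuperOp S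

section Instruments

variable {S : Type} [Fintype S] [DecidableEq S]

/-- The superoperator `ρ ↦ M ρ M†`. -/
def conjMap (M : Matrix S S ℂ) : SuperOp S where
  toFun ρ := M * ρ * M.conjTranspose
  map_add' a b := by simp [mul_add, add_mul]
  map_smul' c a := by simp

/-- Complete positivity, in the form of a finite Kraus decomposition. -/
def IsCP (Φ : SuperOp S) : Prop :=
  ∃ (n : ℕ) (A : Fin n → Matrix S S ℂ), Φ = ∑ i, conjMap (A i)

/-- Preservation of the trace. -/
def IsTP (Φ : SuperOp S) : Prop := ∀ ρ, (Φ ρ).trace = ρ.trace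

/-- A quantum instrument: a family of CP maps whose sum is trace-preserving. -/
def IsInstrument {Θ : Type} (E : OpFamily S Θ) : Prop :=
  (∀ j, IsCP (E j)) ∧ ∀ ρ : Matrix S S ℂ, HasSum (fun j => (E j ρ).trace) ρ.trace

/-- `F` is the coarse-graining of `E` by some map `f` of the outcomes. -/
def IsCoarseGraining {Θ Θ' : Type} (F : OpFamily S Θ') (E : OpFamily S Θ) : Prop :=
  ∃ f : Θ → Θ', ∀ (k : Θ') (ρ : Matrix S S ℂ),
    HasSum (fun j : {j : Θ // f j = k} => E j.1 ρ) (F k ρ)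

/-- The trace norm: the sum of the singular values. -/
def traceNorm {R : Type} [Fintype R] [DecidableEq R] (X : Matrix R R ℂ) : ℝ :=
  ∑ i, √((Matrix.isHermitian_conjTranspose_mul_self X).eigenvalues i)

/-- The ampliation `Φ ⊗ id` with a `k`-dimensional auxiliary system. -/
def ampliate (k : ℕ) (Φ : SuperOp S) (X : Matrix (S × Fin k) (S × Fin k) ℂ) :
    Matrix (S × Fin k) (S × Fin k) ℂ :=
  Matrix.of fun a b => Φ (Matrix.of fun u v => X (u, a.2) (v, b.2)) a.1 b.1

/-- The diamond norm: the supremum of the trace norms of `(Φ ⊗ id) X` over all auxiliary systems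
and all `X` of trace norm at most one. -/
def diamondNorm (Φ : SuperOp S) : ENNReal :=
  ⨆ (k : ℕ) (X : Matrix (S × Fin k) (S × Fin k) ℂ) (_ : traceNorm X ≤ 1),
    ENNReal.ofReal (traceNorm (ampliate k Φ X))

/-- The distance of two instruments: the sum of the diamond norms of the differences. -/
def instrumentDist {Θ : Type} (E F : OpFamily S Θ) : ENNReal :=
  ∑' j, diamondNorm (E j - F j)

end Instruments

/-! ## Three qubits -/

/-- The computational basis of three qubits; the parties `A, B, C` are `0, 1, 2 : Fin 3`. -/
abbrev Bits : Type := Fin 3 → Fin 2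

/-- The operator `M 0 ⊗ M 1 ⊗ M 2`. -/
def tensorOp (M : Fin 3 → Matrix (Fin 2) (Fin 2) ℂ) : Matrix Bits Bits ℂ :=
  Matrix.of fun s t => ∏ J, M J (s J) (t J)

/-- The superoperator `Φ 0 ⊗ Φ 1 ⊗ Φ 2`, by its action on the matrix units `|u⟩⟨v|`. -/
def tensorMap (Φ : Fin 3 → SuperOp (Fin 2)) : SuperOp Bits where
  toFun ρ := Matrix.of fun s t =>
    ∑ u : Bits, ∑ v : Bits, (∏ J, Φ J (Matrix.single (u J) (v J) 1) (s J) (t J)) * ρ u v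
  map_add' a b := by
    ext s t
    simp [mul_add, Finset.sum_add_distrib]
  map_smul' c a := by
    ext s t
    simp [Finset.mul_sum, mul_left_comm]

/-- The operator acting as `M` on party `K` and as the identity on the other two parties. -/
def localOp (K : Fin 3) (M : Matrix (Fin 2) (Fin 2) ℂ) : Matrix Bits Bits ℂ :=
  tensorOp (Function.update (fun _ => 1) K M)

/-! ## LOCC -/

/-- One-way local instruments with respect to party `K`: party `K` applies a CP map, and the other
parties apply TCP maps that may depend on the outcome. -/
def IsOneWayLocal {Θ : Type} (K : Fin 3) (E : OpFamily Bits Θ) : Prop :=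
  IsInstrument E ∧ ∃ Φ : Θ → Fin 3 → SuperOp (Fin 2),
    ∀ j, E j = tensorMap (Φ j) ∧ (∀ J, IsCP (Φ j J)) ∧ ∀ J, J ≠ K → IsTP (Φ j J)

/-- `E'` is LOCC linked to `E`: after outcome `j` of `E` a one-way local instrument `B j` with
respect to a party `K j` is applied, and the result is coarse-grained. -/
def IsLOCCLinked {Θ Θ' : Type} (E' : OpFamily Bits Θ') (E : OpFamily Bits Θ) : Prop :=
  ∃ (κ : Θ → Type) (_ : ∀ j, Countable (κ j)) (K : Θ → Fin 3)
    (B : (j : Θ) → OpFamily Bits (κ j)),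
    (∀ j, IsOneWayLocal (K j) (B j)) ∧
      IsCoarseGraining E' (fun i : (j : Θ) × κ j => B i.1 i.2 ∘ₗ E i.1)

/-- The classes `LOCC_r`, for `r ≥ 1` (there is no instrument with `r = 0`). -/
inductive IsLOCCRounds : ℕ → {Θ : Type} → OpFamily Bits Θ → Prop
  | one {Θ ι : Type} [Countable Θ] [Countable ι] (K : Fin 3) (E : OpFamily Bits ι)
      (F : OpFamily Bits Θ) (hE : IsOneWayLocal K E) (hF : IsCoarseGraining F E) :
      IsLOCCRounds 1 F
  | succ {Θ Θ' : Type} [Countable Θ'] (r : ℕ) (E : OpFamily Bits Θ) (E' : OpFamily Bits Θ')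
      (hE : IsLOCCRounds r E) (hE' : IsLOCCLinked E' E) : IsLOCCRounds (r + 1) E'

/-- The class of instruments implemented by protocols with finitely many rounds. -/
def IsLOCCFinite {Θ : Type} (E : OpFamily Bits Θ) : Prop := ∃ r : ℕ, IsLOCCRounds r E

/-- The class `LOCC`, infinitely many rounds included: the instruments `E` that are the limit of
coarse-grainings `G ν` of finite-round instruments `F ν`, each linked to the one before. -/
def IsLOCC {Θ : Type} (E : OpFamily Bits Θ) : Prop :=
  IsInstrument E ∧
    ∃ (ι : ℕ → Type) (F : (ν : ℕ) → OpFamily Bits (ι ν)) (G : ℕ → OpFamily Bits Θ),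
      (∀ ν, IsLOCCFinite (F ν)) ∧ (∀ ν, IsLOCCLinked (F (ν + 1)) (F ν)) ∧
      (∀ ν, IsCoarseGraining (G ν) (F ν)) ∧
      Tendsto (fun ν => instrumentDist (G ν) E) atTop (𝓝 0)

/-- The family `ρ ↦ M_j ρ M_j†` of a measurement by party `K` with Kraus operators `M_j`. -/
def localMeasurement {Θ : Type} (K : Fin 3) (M : Θ → Matrix (Fin 2) (Fin 2) ℂ) :
    OpFamily Bits Θ :=
  fun j => conjMap (localOp K (M j))

/-- The completeness relation `∑ M_j† M_j = 1`. -/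
def IsMeasurement {Θ : Type} (M : Θ → Matrix (Fin 2) (Fin 2) ℂ) : Prop :=
  HasSum (fun j => (M j).conjTranspose * M j) 1

/-- A trivial measurement: every Kraus operator is a multiple of a unitary. -/
def IsTrivialMeasurement {Θ : Type} (M : Θ → Matrix (Fin 2) (Fin 2) ℂ) : Prop :=
  ∀ j, ∃ (c : ℂ) (U : Matrix (Fin 2) (Fin 2) ℂ),
    U ∈ Matrix.unitaryGroup (Fin 2) ℂ ∧ M j = c • U

/-! ## Pure states, the W class and the function `𝒞` -/

/-- `|ψ⟩⟨ψ|`. -/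
def ketbra (ψ : Bits → ℂ) : Matrix Bits Bits ℂ := Matrix.vecMulVec ψ (star ψ)

/-- Applied to the pure state `ψ`, the family `E` produces outcome `j` with probability `p j` and
then leaves the normalized pure state `φ j`. (If `p j = 0`, then `φ j` is an irrelevant unit
vector.) -/
def YieldsPure {Θ : Type} (E : OpFamily Bits Θ) (ψ : Bits → ℂ) (p : Θ → ℝ)
    (φ : Θ → Bits → ℂ) : Prop :=
  ∀ j, 0 ≤ p j ∧ ∑ s, ‖φ j s‖ ^ 2 = 1 ∧ E j (ketbra ψ) = (p j : ℂ) • ketbra (φ j)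

/-- `√x₀|000⟩ + √x_A|100⟩ + √x_B|010⟩ + √x_C|001⟩` with `x₀ = 1 - x_A - x_B - x_C`. -/
def wKet (x : Fin 3 → ℝ) : Bits → ℂ := fun s =>
  (if s = 0 then ((√(1 - ∑ K, x K) : ℝ) : ℂ) else 0) +
    ∑ K, if s = Pi.single K 1 then ((√(x K) : ℝ) : ℂ) else 0

/-- `ψ` is a W-class state with parameters `x`: it is locally unitarily equivalent to `wKet x`.
If all entries are positive then `x` is determined by `ψ`. If an entry is zero, several vectors `x`
can occur and the usual convention selects one of them; no selection is made here, so what is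
stated for every vector of parameters holds in particular for the selected one. -/
def HasWParams (ψ : Bits → ℂ) (x : Fin 3 → ℝ) : Prop :=
  (∀ K, 0 ≤ x K) ∧ ∑ K, x K ≤ 1 ∧
    ∃ U : Fin 3 → Matrix (Fin 2) (Fin 2) ℂ,
      (∀ J, U J ∈ Matrix.unitaryGroup (Fin 2) ℂ) ∧ ψ = (tensorOp U).mulVec (wKet x)

/-- The W class of normalized pure three-qubit states. -/
def IsWClass (ψ : Bits → ℂ) : Prop := ∃ x, HasWParams ψ x

/-- `n₁` may serve as the first of the parties other than `⋆`: no such party has a larger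
parameter. -/
def IsFirstParty (star : Fin 3) (x : Fin 3 → ℝ) (n₁ : Fin 3) : Prop :=
  n₁ ≠ star ∧ ∀ J, J ≠ star → x J ≤ x n₁

/-- The function `𝒞` for the fixed party `⋆`. The other two parties are `⋆ + 1` and `⋆ + 2` in
`Fin 3`, the larger of their parameters is `x_{n₁}` and the smaller is `x_{n₂}`. -/
def concFun (star : Fin 3) (x : Fin 3 → ℝ) : ℝ :=
  let x₁ := max (x (star + 1)) (x (star + 2))
  let x₂ := min (x (star + 1)) (x (star + 2))
  if x₁ ≠ 0 then 2 * √(x star * x₁) + 2 / 3 * x₂ * √(x star / x₁) else 0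

end

noncomputable section

/-! ## Algebra of product operators -/

/-! The function `concFun` depends only on the two concurrences u and v that `⋆` shares with the
other parties. Their squares are linear combinations of determinants of reduced states. Hence `conc`
is a continuous, locally unitarily invariant function on all vectors with `conc (a • ξ) = |a|² conc
ξ`, so it can be applied to unnormalized outcomes and does not depend on the choice of parameters.

For a Kraus operator M of party K on a W-type vector with local frame U, write M U_K = V T with V
unitary and T upper triangular. Then T keeps the W form, and with r = |T₀₀| and t = |T₁₁| each
concurrence is multiplied by r t or by r². As a function of (r², t²), the new value lies below its
tangent plane A r² + B t² along r = t, where A + B is the old value. Since r² and t² are bounded by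
the squared norms of M on the two columns of U_K, the completeness relation gives monotonicity for
one local measurement (`IsWCone.exists_local_bound`). Strictness follows because a non-trivial
measurement has an outcome at which this bound is strict (`IsWCone.tsum_conc_measurement_lt`).

Instruments in LOCC may pass through mixed states, so their monotonicity is phrased dually: a
real-linear functional is feasible if it is at most `conc` on all pure states of the cone, and a
family is monotone if pulling back feasible functionals gives a feasible one. This property passes
through coarse-graining, composition and outcome-wise limits (`IsLOCC.isMonotoneFamily`). To return
to pure outputs, compactness of the W class provides, for each unit vector φ in the cone, feasible
functionals whose values at φ are arbitrarily close to `conc φ`, and for each unit vector outside it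
functionals with arbitrarily large values (`exists_support`). The latter force the outputs to be
W-class, the former give the inequality. -/

theorem sum_bits_prod {R : Type*} [CommSemiring R] (g : Fin 3 → Fin 2 → R) :
    ∑ s : Bits, ∏ J, g J (s J) = ∏ J, ∑ a, g J a := by
  rw [Finset.prod_univ_sum, Fintype.piFinset_univ]

theorem tensorOp_mul (M N : Fin 3 → Matrix (Fin 2) (Fin 2) ℂ) :
    tensorOp M * tensorOp N = tensorOp (fun J => M J * N J) := by
  ext s t
  simp only [tensorOp, Matrix.mul_apply, Matrix.of_apply, ← Finset.prod_mul_distrib]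
  exact sum_bits_prod (fun J a => M J (s J) a * N J a (t J))

theorem tensorOp_conjTranspose (M : Fin 3 → Matrix (Fin 2) (Fin 2) ℂ) :
    (tensorOp M).conjTranspose = tensorOp (fun J => (M J).conjTranspose) := by
  ext s t
  simp [tensorOp, Matrix.conjTranspose_apply]

theorem tensorOp_one : tensorOp (fun _ => 1) = 1 := by
  ext s t
  by_cases h : s = t
  · subst h; simp [tensorOp]
  · obtain ⟨J, hJ⟩ := Function.ne_iff.mp h
    rw [Matrix.one_apply_ne h]
    change ∏ J, (1 : Matrix (Fin 2) (Fin 2) ℂ) (s J) (t J) = 0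
    exact Finset.prod_eq_zero (Finset.mem_univ J) (Matrix.one_apply_ne hJ)

theorem trace_tensorOp (M : Fin 3 → Matrix (Fin 2) (Fin 2) ℂ) :
    (tensorOp M).trace = ∏ J, (M J).trace := by
  simpa [tensorOp, Matrix.trace] using sum_bits_prod (fun J a => M J a a)

theorem tensorOp_update_apply (M : Fin 3 → Matrix (Fin 2) (Fin 2) ℂ) (K : Fin 3)
    (N : Matrix (Fin 2) (Fin 2) ℂ) (s t : Bits) :
    tensorOp (Function.update M K N) s t
      = N (s K) (t K) * ∏ J ∈ Finset.univ.erase K, M J (s J) (t J) := by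
  simp only [tensorOp, Matrix.of_apply]
  rw [← Finset.mul_prod_erase _ _ (Finset.mem_univ K), Function.update_self]
  congr 1
  refine Finset.prod_congr rfl fun J hJ => ?_
  rw [Function.update_of_ne (Finset.ne_of_mem_erase hJ)]

/-- `tensorOp` as a linear function of the factor of party `K`. -/
def tensorOpLin (M : Fin 3 → Matrix (Fin 2) (Fin 2) ℂ) (K : Fin 3) :
    Matrix (Fin 2) (Fin 2) ℂ →ₗ[ℂ] Matrix Bits Bits ℂ where
  toFun N := tensorOp (Function.update M K N)
  map_add' a b := by ext s t; simp [tensorOp_update_apply, add_mul]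
  map_smul' c a := by ext s t; simp [tensorOp_update_apply, mul_assoc]

theorem tensorOpLin_apply (M : Fin 3 → Matrix (Fin 2) (Fin 2) ℂ) (K : Fin 3)
    (N : Matrix (Fin 2) (Fin 2) ℂ) : tensorOpLin M K N = tensorOp (Function.update M K N) := rfl

theorem localOp_mul_tensorOp (K : Fin 3) (M : Matrix (Fin 2) (Fin 2) ℂ)
    (U : Fin 3 → Matrix (Fin 2) (Fin 2) ℂ) :
    localOp K M * tensorOp U = tensorOp (Function.update U K (M * U K)) := by
  rw [localOp, tensorOp_mul]
  congr 1
  ext1 J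
  by_cases h : J = K
  · subst h; simp
  · simp [h]

theorem tensorOp_mul_localOp (K : Fin 3) (M : Matrix (Fin 2) (Fin 2) ℂ)
    (U : Fin 3 → Matrix (Fin 2) (Fin 2) ℂ) :
    tensorOp U * localOp K M = tensorOp (Function.update U K (U K * M)) := by
  rw [localOp, tensorOp_mul]
  congr 1
  ext1 J
  by_cases h : J = K
  · subst h; simp
  · simp [h]

theorem localOp_conjTranspose (K : Fin 3) (M : Matrix (Fin 2) (Fin 2) ℂ) :
    (localOp K M).conjTranspose = localOp K M.conjTranspose := by
  rw [localOp, tensorOp_conjTranspose, localOp]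
  congr 1
  ext1 J
  by_cases h : J = K
  · subst h; simp
  · simp [h]

theorem tensorOp_unitary {U : Fin 3 → Matrix (Fin 2) (Fin 2) ℂ}
    (hU : ∀ J, U J ∈ Matrix.unitaryGroup (Fin 2) ℂ) :
    (tensorOp U).conjTranspose * tensorOp U = 1 := by
  rw [tensorOp_conjTranspose, tensorOp_mul, ← tensorOp_one]
  congr 1
  ext1 J
  exact Matrix.mem_unitaryGroup_iff'.mp (hU J)

theorem localOp_mulVec (K : Fin 3) (M : Matrix (Fin 2) (Fin 2) ℂ) (ξ : Bits → ℂ) (s : Bits) :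
    (localOp K M).mulVec ξ s = ∑ b, M (s K) b * ξ (Function.update s K b) := by
  have key : ∀ t : Bits, localOp K M s t
      = ∑ b, if t = Function.update s K b then M (s K) b else 0 := by
    intro t
    rw [localOp, tensorOp_update_apply]
    by_cases h : ∀ J, J ≠ K → s J = t J
    · have ht : ∀ b, (t = Function.update s K b) ↔ b = t K := by
        intro b
        constructor
        · intro e; rw [e]; simp
        · rintro rfl
          ext1 J
          by_cases hJ : J = K
          · subst hJ; simp
          · simp [hJ, h J hJ]
      simp only [ht, Finset.sum_ite_eq', Finset.mem_univ, if_true]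
      rw [Finset.prod_eq_one, mul_one]
      intro J hJ
      rw [h J (Finset.ne_of_mem_erase hJ), Matrix.one_apply_eq]
    · push Not at h
      obtain ⟨J, hJ, hne⟩ := h
      have h0 : ∏ J ∈ Finset.univ.erase K, (1 : Matrix (Fin 2) (Fin 2) ℂ) (s J) (t J) = 0 :=
        Finset.prod_eq_zero (Finset.mem_erase.mpr ⟨hJ, Finset.mem_univ J⟩)
          (Matrix.one_apply_ne hne)
      rw [h0, mul_zero]
      refine (Finset.sum_eq_zero fun b _ => if_neg fun e => hne ?_).symm
      rw [e, Function.update_of_ne hJ]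
  simp only [Matrix.mulVec, dotProduct, key, Finset.sum_mul]
  rw [Finset.sum_comm]
  refine Finset.sum_congr rfl fun b _ => ?_
  simp [ite_mul]

/-! ## Pure states and conjugation -/

theorem conjMap_apply {S : Type} [Fintype S] [DecidableEq S] (M ρ : Matrix S S ℂ) :
    conjMap M ρ = M * ρ * M.conjTranspose := rfl

theorem conjMap_vecMulVec {S : Type} [Fintype S] [DecidableEq S] (M : Matrix S S ℂ) (v : S → ℂ) :
    conjMap M (Matrix.vecMulVec v (star v))
      = Matrix.vecMulVec (M.mulVec v) (star (M.mulVec v)) := by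
  rw [conjMap_apply, Matrix.mul_vecMulVec, Matrix.vecMulVec_mul, Matrix.star_mulVec]

theorem conjMap_ketbra (M : Matrix Bits Bits ℂ) (ξ : Bits → ℂ) :
    conjMap M (ketbra ξ) = ketbra (M.mulVec ξ) := conjMap_vecMulVec M ξ

/-- The squared Euclidean norm. -/
def sqNorm {S : Type} [Fintype S] (v : S → ℂ) : ℝ := ∑ s, ‖v s‖ ^ 2

theorem sqNorm_nonneg {S : Type} [Fintype S] (v : S → ℂ) : 0 ≤ sqNorm v :=
  Finset.sum_nonneg fun _ _ => sq_nonneg _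

theorem sqNorm_eq_zero {S : Type} [Fintype S] {v : S → ℂ} (h : sqNorm v = 0) : v = 0 := by
  ext s
  have := (Finset.sum_eq_zero_iff_of_nonneg (fun i _ => sq_nonneg ‖v i‖)).mp h s
    (Finset.mem_univ s)
  simpa using this

theorem sqNorm_smul {S : Type} [Fintype S] (a : ℂ) (v : S → ℂ) :
    sqNorm (a • v) = ‖a‖ ^ 2 * sqNorm v := by
  simp [sqNorm, Finset.mul_sum, mul_pow]

theorem star_dotProduct_self {S : Type} [Fintype S] (v : S → ℂ) :
    star v ⬝ᵥ v = (sqNorm v : ℂ) := by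
  simp only [dotProduct, sqNorm, Pi.star_apply, Complex.ofReal_sum, Complex.ofReal_pow]
  refine Finset.sum_congr rfl fun s _ => ?_
  exact Complex.conj_mul' (v s)

theorem trace_vecMulVec_star {S : Type} [Fintype S] (v : S → ℂ) :
    (Matrix.vecMulVec v (star v)).trace = (sqNorm v : ℂ) := by
  rw [Matrix.trace_vecMulVec, dotProduct_comm, star_dotProduct_self]

theorem sqNorm_mulVec {S : Type} [Fintype S] [DecidableEq S] (M : Matrix S S ℂ) (v : S → ℂ) :
    (sqNorm (M.mulVec v) : ℂ) = star v ⬝ᵥ (M.conjTranspose * M).mulVec v := by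
  rw [← star_dotProduct_self, Matrix.star_mulVec, ← Matrix.dotProduct_mulVec,
    Matrix.mulVec_mulVec]

theorem sqNorm_unitary {S : Type} [Fintype S] [DecidableEq S] {M : Matrix S S ℂ}
    (hM : M.conjTranspose * M = 1) (v : S → ℂ) : sqNorm (M.mulVec v) = sqNorm v := by
  have h := sqNorm_mulVec M v
  rw [hM, Matrix.one_mulVec, star_dotProduct_self] at h
  exact_mod_cast h

theorem ketbra_smul (a : ℂ) (ξ : Bits → ℂ) :
    ketbra (a • ξ) = ((‖a‖ ^ 2 : ℝ) : ℂ) • ketbra ξ := by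
  ext s t
  simp only [ketbra, Matrix.vecMulVec_apply, Pi.smul_apply, Pi.star_apply, smul_eq_mul, star_mul',
    Matrix.smul_apply]
  rw [Complex.ofReal_pow, ← Complex.mul_conj']
  simp only [RCLike.star_def]
  ring

theorem eq_smul_of_ketbra_eq {ξ η : Bits → ℂ} (hη : η ≠ 0) (h : ketbra ξ = ketbra η) :
    ∃ a : ℂ, η = a • ξ := by
  obtain ⟨t, ht⟩ := Function.ne_iff.mp hη
  refine ⟨star (ξ t) / star (η t), ?_⟩
  ext s
  have := congrFun (congrFun h s) t
  simp only [ketbra, Matrix.vecMulVec_apply, Pi.star_apply] at this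
  have h0 : star (η t) ≠ 0 := by simpa using ht
  rw [Pi.smul_apply, smul_eq_mul]
  field_simp
  rw [← this]; ring

/-! ## Reduced states -/

/-- The reduced state of party `K`. -/
def redMat (K : Fin 3) (ρ : Matrix Bits Bits ℂ) : Matrix (Fin 2) (Fin 2) ℂ :=
  Matrix.of fun a b => (localOp K (Matrix.single b a 1) * ρ).trace

/-- This duality characterizes the partial trace. Both sides are linear in `N`, so matrix units
suffice, and there it is the definition of `redMat`. -/
theorem trace_localOp_mul (K : Fin 3) (N : Matrix (Fin 2) (Fin 2) ℂ) (ρ : Matrix Bits Bits ℂ) :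
    (localOp K N * ρ).trace = (N * redMat K ρ).trace := by
  have hlin : ∀ N, (localOp K N * ρ).trace
      = (Matrix.traceLinearMap Bits ℂ ℂ ∘ₗ LinearMap.mulRight ℂ ρ ∘ₗ
          tensorOpLin (fun _ => 1) K) N := fun N => rfl
  rw [hlin, Matrix.matrix_eq_sum_single N]
  simp only [map_sum, Matrix.sum_mul, Matrix.trace_sum]
  refine Finset.sum_congr rfl fun a _ => Finset.sum_congr rfl fun b _ => ?_
  have : Matrix.single a b (N a b) = N a b • Matrix.single a b (1 : ℂ) := by simp
  rw [this, map_smul, ← hlin, Matrix.smul_mul, Matrix.trace_smul, Matrix.trace_single_mul]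
  simp [redMat]

theorem redMat_conjMap_tensorOp (K : Fin 3) {U : Fin 3 → Matrix (Fin 2) (Fin 2) ℂ}
    (hU : ∀ J, U J ∈ Matrix.unitaryGroup (Fin 2) ℂ) (ρ : Matrix Bits Bits ℂ) :
    redMat K (conjMap (tensorOp U) ρ) = U K * redMat K ρ * (U K).conjTranspose := by
  ext a b
  have h1 : (tensorOp U).conjTranspose * (localOp K (Matrix.single b a 1) * tensorOp U)
      = localOp K ((U K).conjTranspose * Matrix.single b a 1 * U K) := by
    rw [localOp_mul_tensorOp, tensorOp_conjTranspose, tensorOp_mul, localOp]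
    congr 1
    ext1 J
    by_cases h : J = K
    · subst h; simp [mul_assoc]
    · simpa [h, ← Matrix.star_eq_conjTranspose] using Matrix.mem_unitaryGroup_iff'.mp (hU J)
  have h2 : redMat K (conjMap (tensorOp U) ρ) a b
      = ((tensorOp U).conjTranspose * (localOp K (Matrix.single b a 1) * tensorOp U) * ρ).trace := by
    rw [redMat, Matrix.of_apply, conjMap_apply, ← mul_assoc, ← mul_assoc, Matrix.trace_mul_comm]
    simp only [mul_assoc]
  rw [h2, h1, trace_localOp_mul]
  have h3 : ((U K).conjTranspose * Matrix.single b a 1 * U K * redMat K ρ).trace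
      = (Matrix.single b a 1 * (U K * redMat K ρ * (U K).conjTranspose)).trace := by
    rw [mul_assoc, mul_assoc, Matrix.trace_mul_comm]
    simp only [mul_assoc]
  rw [h3, Matrix.trace_single_mul]
  simp

/-- The determinant of the reduced state of party `K`. -/
def redDet (K : Fin 3) (ρ : Matrix Bits Bits ℂ) : ℝ := (redMat K ρ).det.re

theorem redDet_conjMap_tensorOp (K : Fin 3) {U : Fin 3 → Matrix (Fin 2) (Fin 2) ℂ}
    (hU : ∀ J, U J ∈ Matrix.unitaryGroup (Fin 2) ℂ) (ρ : Matrix Bits Bits ℂ) :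
    redDet K (conjMap (tensorOp U) ρ) = redDet K ρ := by
  rw [redDet, redMat_conjMap_tensorOp K hU, mul_assoc, Matrix.det_mul_comm, mul_assoc]
  have : (U K).conjTranspose * U K = 1 := Matrix.mem_unitaryGroup_iff'.mp (hU K)
  rw [this, mul_one, redDet]

theorem redMat_smul (K : Fin 3) (c : ℂ) (ρ : Matrix Bits Bits ℂ) :
    redMat K (c • ρ) = c • redMat K ρ := by
  ext a b
  simp [redMat]

theorem redDet_smul (K : Fin 3) (r : ℝ) (ρ : Matrix Bits Bits ℂ) :
    redDet K ((r : ℂ) • ρ) = r ^ 2 * redDet K ρ := by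
  rw [redDet, redMat_smul, Matrix.det_smul, redDet, Fintype.card_fin, ← Complex.ofReal_pow,
    Complex.re_ofReal_mul]

theorem continuous_redDet_ketbra (K : Fin 3) : Continuous fun ξ => redDet K (ketbra ξ) := by
  have hk : Continuous ketbra := by
    unfold ketbra
    exact Continuous.matrix_vecMulVec continuous_id (continuous_star.comp continuous_id)
  have h : Continuous fun ξ => redMat K (ketbra ξ) := by
    refine continuous_matrix fun a b => ?_
    simp only [redMat, Matrix.of_apply]
    exact (continuous_const.matrix_mul hk).matrix_trace
  exact Complex.continuous_re.comp h.matrix_det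

/-! ## W-type vectors -/

/-- `c₀|000⟩ + c_A|100⟩ + c_B|010⟩ + c_C|001⟩`. -/
def wVec (c₀ : ℂ) (c : Fin 3 → ℂ) : Bits → ℂ := fun s =>
  (if s = 0 then c₀ else 0) + ∑ K, if s = Pi.single K 1 then c K else 0

theorem wKet_eq_wVec (x : Fin 3 → ℝ) :
    wKet x = wVec ((√(1 - ∑ K, x K) : ℝ) : ℂ) (fun K => ((√(x K) : ℝ) : ℂ)) := rfl

theorem univ_bits : (Finset.univ : Finset Bits) =
    {![0, 0, 0], ![1, 0, 0], ![0, 1, 0], ![0, 0, 1], ![1, 1, 0], ![1, 0, 1], ![0, 1, 1],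
      ![1, 1, 1]} := by decide

theorem sum_bits {R : Type*} [AddCommMonoid R] (g : Bits → R) :
    ∑ s, g s = g ![0, 0, 0] + g ![1, 0, 0] + g ![0, 1, 0] + g ![0, 0, 1] + g ![1, 1, 0]
      + g ![1, 0, 1] + g ![0, 1, 1] + g ![1, 1, 1] := by
  rw [univ_bits]
  repeat rw [Finset.sum_insert (by decide)]
  rw [Finset.sum_singleton]
  simp only [add_assoc]

theorem wVec_values (c₀ : ℂ) (c : Fin 3 → ℂ) :
    wVec c₀ c ![0, 0, 0] = c₀ ∧ wVec c₀ c ![1, 0, 0] = c 0 ∧ wVec c₀ c ![0, 1, 0] = c 1 ∧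
    wVec c₀ c ![0, 0, 1] = c 2 ∧ wVec c₀ c ![1, 1, 0] = 0 ∧ wVec c₀ c ![1, 0, 1] = 0 ∧
    wVec c₀ c ![0, 1, 1] = 0 ∧ wVec c₀ c ![1, 1, 1] = 0 := by
  have h0 : ∀ s : Bits, s = 0 ↔ (s 0 = 0 ∧ s 1 = 0 ∧ s 2 = 0) := by decide
  have h1 : ∀ s : Bits, s = Pi.single 0 1 ↔ (s 0 = 1 ∧ s 1 = 0 ∧ s 2 = 0) := by decide
  have h2 : ∀ s : Bits, s = Pi.single 1 1 ↔ (s 0 = 0 ∧ s 1 = 1 ∧ s 2 = 0) := by decide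
  have h3 : ∀ s : Bits, s = Pi.single 2 1 ↔ (s 0 = 0 ∧ s 1 = 0 ∧ s 2 = 1) := by decide
  simp [wVec, Fin.sum_univ_three, h0, h1, h2, h3]

theorem eq_of_bits {R : Type*} {g h : Bits → R} (h0 : g ![0, 0, 0] = h ![0, 0, 0])
    (h1 : g ![1, 0, 0] = h ![1, 0, 0]) (h2 : g ![0, 1, 0] = h ![0, 1, 0])
    (h3 : g ![0, 0, 1] = h ![0, 0, 1]) (h4 : g ![1, 1, 0] = h ![1, 1, 0])
    (h5 : g ![1, 0, 1] = h ![1, 0, 1]) (h6 : g ![0, 1, 1] = h ![0, 1, 1])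
    (h7 : g ![1, 1, 1] = h ![1, 1, 1]) : g = h := by
  ext1 s
  have : s ∈ (Finset.univ : Finset Bits) := Finset.mem_univ s
  rw [univ_bits] at this
  simp only [Finset.mem_insert, Finset.mem_singleton] at this
  rcases this with rfl | rfl | rfl | rfl | rfl | rfl | rfl | rfl <;> assumption

theorem sqNorm_wVec (c₀ : ℂ) (c : Fin 3 → ℂ) :
    sqNorm (wVec c₀ c) = ‖c₀‖ ^ 2 + ∑ K, ‖c K‖ ^ 2 := by
  obtain ⟨h0, h1, h2, h3, h4, h5, h6, h7⟩ := wVec_values c₀ c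
  rw [sqNorm, sum_bits, h0, h1, h2, h3, h4, h5, h6, h7, Fin.sum_univ_three]
  simp
  ring

theorem smul_wVec (a c₀ : ℂ) (c : Fin 3 → ℂ) : a • wVec c₀ c = wVec (a * c₀) (a • c) := by
  ext s
  simp [wVec, mul_add, Finset.mul_sum]

theorem update_bits (a b c d : Fin 2) :
    Function.update ![a, b, c] 0 d = ![d, b, c] ∧ Function.update ![a, b, c] 1 d = ![a, d, c] ∧
      Function.update ![a, b, c] 2 d = ![a, b, d] := by
  revert a b c d; decide

/-- An upper triangular operator on party `K` preserves the form of a W-type vector. -/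
theorem localOp_mulVec_wVec (K : Fin 3) (T : Matrix (Fin 2) (Fin 2) ℂ) (hT : T 1 0 = 0) (c₀ : ℂ)
    (c : Fin 3 → ℂ) : (localOp K T).mulVec (wVec c₀ c)
      = wVec (T 0 0 * c₀ + T 0 1 * c K) (fun J => if J = K then T 1 1 * c J else T 0 0 * c J) := by
  obtain ⟨g0, g1, g2, g3, g4, g5, g6, g7⟩ := wVec_values c₀ c
  fin_cases K <;>
  · refine eq_of_bits ?_ ?_ ?_ ?_ ?_ ?_ ?_ ?_ <;>
    simp [localOp_mulVec, Fin.sum_univ_two, update_bits, g0, g1, g2, g3, g4, g5, g6, g7, hT] <;>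
    simp [wVec_values]

theorem redDet_wVec (K : Fin 3) (c₀ : ℂ) (c : Fin 3 → ℂ) :
    redDet K (ketbra (wVec c₀ c)) = ‖c K‖ ^ 2 * (‖c (K + 1)‖ ^ 2 + ‖c (K + 2)‖ ^ 2) := by
  obtain ⟨g0, g1, g2, g3, g4, g5, g6, g7⟩ := wVec_values c₀ c
  have key : ∀ (N : Matrix (Fin 2) (Fin 2) ℂ), (localOp K N * ketbra (wVec c₀ c)).trace
      = ∑ s, (∑ b, N (s K) b * wVec c₀ c (Function.update s K b)) * star (wVec c₀ c s) := by
    intro N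
    rw [ketbra, Matrix.mul_vecMulVec, Matrix.trace_vecMulVec]
    simp only [dotProduct, localOp_mulVec, Pi.star_apply]
  have hC : ((redMat K (ketbra (wVec c₀ c))).det)
      = ((‖c K‖ ^ 2 * (‖c (K + 1)‖ ^ 2 + ‖c (K + 2)‖ ^ 2) : ℝ) : ℂ) := by
    rw [Matrix.det_fin_two]
    simp only [redMat, Matrix.of_apply, key, sum_bits, Fin.sum_univ_two]
    push_cast
    simp only [← Complex.mul_conj']
    fin_cases K <;>
    · simp [update_bits, g0, g1, g2, g3, g4, g5, g6, g7]
      ring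
  rw [redDet, hC, Complex.ofReal_re]

/-! ## The function `max + min² / (3 max)` -/

/-- `𝒞` in terms of the two concurrences `2√(x_⋆ x_{n₁})` and `2√(x_⋆ x_{n₂})`. -/
def concPair (u v : ℝ) : ℝ := max u v + min u v ^ 2 / (3 * max u v)

theorem concPair_comm (u v : ℝ) : concPair u v = concPair v u := by
  rw [concPair, concPair, max_comm, min_comm]

theorem concPair_of_le {u v : ℝ} (h : v ≤ u) : concPair u v = u + v ^ 2 / (3 * u) := by
  rw [concPair, max_eq_left h, min_eq_right h]

theorem concPair_of_ge {u v : ℝ} (h : u ≤ v) : concPair u v = v + u ^ 2 / (3 * v) := by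
  rw [concPair_comm, concPair_of_le h]

theorem concPair_nonneg {u v : ℝ} (hu : 0 ≤ u) : 0 ≤ concPair u v := by
  have : 0 ≤ max u v := le_max_of_le_left hu
  unfold concPair
  positivity

theorem concPair_mul {r u v : ℝ} (hr : 0 ≤ r) : concPair (r * u) (r * v) = r * concPair u v := by
  rcases hr.eq_or_lt with rfl | hr'
  · simp [concPair]
  rw [concPair, concPair, ← mul_max_of_nonneg _ _ hr, ← mul_min_of_nonneg _ _ hr, mul_add]
  congr 1
  rcases eq_or_ne (max u v) 0 with h | h
  · simp [h]
  · field_simp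

/-- The left side is homogeneous of degree 2 in (r, t); the coefficients on the right are half its
partial derivatives at r = t = 1, so the two sides touch along r = t. On either branch of the
maximum the difference factors with a square. -/
theorem concPair_measure_of_le {u v r t : ℝ} (hu : 0 < u) (hv : 0 ≤ v) (hvu : v ≤ u) (hr : 0 ≤ r)
    (ht : 0 ≤ t) : concPair (r * t * u) (r ^ 2 * v)
      ≤ (u / 2 + v ^ 2 / (2 * u)) * r ^ 2 + (u / 2 - v ^ 2 / (6 * u)) * t ^ 2 := by
  have hB : 0 ≤ u / 2 - v ^ 2 / (6 * u) := by
    rw [sub_nonneg, div_le_div_iff₀ (by positivity) (by positivity)]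
    nlinarith
  rcases hr.eq_or_lt with rfl | hr
  · have : concPair (0 * t * u) (0 ^ 2 * v) = 0 := by simp [concPair]
    rw [this]; positivity
  rcases le_or_gt (r * v) (t * u) with h | h
  · rw [concPair_of_le (by nlinarith)]
    rcases ht.eq_or_lt with rfl | ht
    · have : v = 0 := by nlinarith
      subst this; simp; positivity
    have e : (u / 2 + v ^ 2 / (2 * u)) * r ^ 2 + (u / 2 - v ^ 2 / (6 * u)) * t ^ 2
        - (r * t * u + (r ^ 2 * v) ^ 2 / (3 * (r * t * u)))
        = (r - t) ^ 2 * (3 * u ^ 2 * t - v ^ 2 * (t + 2 * r)) / (6 * u * t) := by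
      field_simp; ring
    have h1 : v ^ 2 * (t + 2 * r) ≤ 3 * u ^ 2 * t := by
      have a1 : v ^ 2 ≤ u ^ 2 := by gcongr
      have a2 : v * (r * v) ≤ u * (t * u) := by gcongr
      nlinarith
    have : 0 ≤ (r - t) ^ 2 * (3 * u ^ 2 * t - v ^ 2 * (t + 2 * r)) / (6 * u * t) := by
      have := sub_nonneg.mpr h1
      positivity
    linarith
  -- Here the order of the two concurrences has been reversed, so the other branch applies; its gap
  -- carries the factor (u - v)².
  · have hv : 0 < v := by
      by_contra hc
      have : v = 0 := by linarith
      subst this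
      have := mul_nonneg ht hu.le
      linarith
    rw [concPair_of_ge (by nlinarith)]
    have e : (u / 2 + v ^ 2 / (2 * u)) * r ^ 2 + (u / 2 - v ^ 2 / (6 * u)) * t ^ 2
        - (r ^ 2 * v + (r * t * u) ^ 2 / (3 * (r ^ 2 * v)))
        = (u - v) ^ 2 * (3 * v * r ^ 2 - t ^ 2 * (v + 2 * u)) / (6 * u * v) := by
      field_simp; ring
    have h1 : t ^ 2 * (v + 2 * u) ≤ 3 * v * r ^ 2 := by
      have a1 : (t * u) ^ 2 ≤ (r * v) ^ 2 := by gcongr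
      have a2 : v * (v + 2 * u) ≤ 3 * u ^ 2 := by nlinarith
      have a3 : (t * u) ^ 2 * (v + 2 * u) ≤ (r * v) ^ 2 * (v + 2 * u) := by gcongr
      have a4 : r ^ 2 * v * (v * (v + 2 * u)) ≤ r ^ 2 * v * (3 * u ^ 2) := by gcongr
      have : u ^ 2 * (t ^ 2 * (v + 2 * u)) ≤ u ^ 2 * (3 * v * r ^ 2) := by linarith
      exact le_of_mul_le_mul_left this (by positivity)
    have : 0 ≤ (u - v) ^ 2 * (3 * v * r ^ 2 - t ^ 2 * (v + 2 * u)) / (6 * u * v) := by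
      have := sub_nonneg.mpr h1
      positivity
    linarith

/-- With v ≤ u and r < t the order of the concurrences is kept, and the factor multiplying (r - t)²
is positive. Strictness is one-sided: for u = v > 0 and t < r the two sides agree. -/
theorem concPair_measure_lt {u v r t : ℝ} (hu : 0 < u) (hv : 0 ≤ v) (hvu : v ≤ u) (hr : 0 ≤ r)
    (ht : r < t) : concPair (r * t * u) (r ^ 2 * v)
      < (u / 2 + v ^ 2 / (2 * u)) * r ^ 2 + (u / 2 - v ^ 2 / (6 * u)) * t ^ 2 := by
  have ht0 : 0 < t := hr.trans_lt ht
  have a1 : v ^ 2 ≤ u ^ 2 := by gcongr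
  rcases hr.eq_or_lt with rfl | hr
  · have h0 : concPair (0 * t * u) (0 ^ 2 * v) = 0 := by simp [concPair]
    have hB : 0 < u / 2 - v ^ 2 / (6 * u) := by
      rw [sub_pos, div_lt_div_iff₀ (by positivity) (by positivity)]
      nlinarith [pow_pos hu 2]
    rw [h0]
    have := mul_pos hB (pow_pos ht0 2)
    nlinarith
  rw [concPair_of_le (by nlinarith [mul_le_mul ht.le hvu hv ht0.le])]
  have e : (u / 2 + v ^ 2 / (2 * u)) * r ^ 2 + (u / 2 - v ^ 2 / (6 * u)) * t ^ 2
      - (r * t * u + (r ^ 2 * v) ^ 2 / (3 * (r * t * u)))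
      = (r - t) ^ 2 * (3 * u ^ 2 * t - v ^ 2 * (t + 2 * r)) / (6 * u * t) := by
    field_simp; ring
  have h1 : v ^ 2 * (t + 2 * r) < 3 * u ^ 2 * t := by
    have : v ^ 2 * (t + 2 * r) ≤ u ^ 2 * (t + 2 * r) := by gcongr
    have : u ^ 2 * (t + 2 * r) < u ^ 2 * (3 * t) := by gcongr; linarith
    linarith
  have : 0 < (r - t) ^ 2 * (3 * u ^ 2 * t - v ^ 2 * (t + 2 * r)) / (6 * u * t) := by
    have := sub_pos.mpr h1
    have := pow_pos (sub_pos.mpr ht) 2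
    have : 0 < (r - t) ^ 2 := by nlinarith
    positivity
  linarith

/-- As long as the order of the concurrences is kept this is an equality, which is why the party
with the smaller concurrence need not cause a strict decrease. After a reversal the gap is a cube:
the two branches of `concPair` agree to second order at u = v, owing to the factor 1/3. -/
theorem concPair_measure_of_ge {u v r t : ℝ} (hu : 0 ≤ u) (hv : 0 < v) (huv : u ≤ v) (hr : 0 ≤ r)
    (ht : 0 ≤ t) : concPair (r * t * u) (r ^ 2 * v) ≤ v * r ^ 2 + u ^ 2 / (3 * v) * t ^ 2 := by
  rcases hr.eq_or_lt with rfl | hr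
  · have : concPair (0 * t * u) (0 ^ 2 * v) = 0 := by simp [concPair]
    rw [this]; positivity
  rcases le_or_gt (t * u) (r * v) with h | h
  · rw [concPair_of_ge (by nlinarith)]
    apply le_of_eq
    field_simp
  · have htu : 0 < t * u := lt_of_le_of_lt (by positivity) h
    rw [concPair_of_le (by nlinarith)]
    have e : v * r ^ 2 + u ^ 2 / (3 * v) * t ^ 2
        - (r * t * u + (r ^ 2 * v) ^ 2 / (3 * (r * t * u)))
        = (t * u - r * v) ^ 3 / (3 * v * (t * u)) := by
      have ht0 : t ≠ 0 := by rintro rfl; simp at htu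
      have hu0 : u ≠ 0 := by rintro rfl; simp at htu
      field_simp; ring
    have : 0 ≤ (t * u - r * v) ^ 3 / (3 * v * (t * u)) := by
      have := sub_pos.mpr h
      positivity
    linarith

theorem exists_concPair_measure {u v : ℝ} (hu : 0 ≤ u) (hv : 0 ≤ v) :
    ∃ A B : ℝ, 0 ≤ A ∧ 0 ≤ B ∧ A + B = concPair u v ∧
      (∀ r t, 0 ≤ r → 0 ≤ t → concPair (r * t * u) (r ^ 2 * v) ≤ A * r ^ 2 + B * t ^ 2) ∧
      (0 < concPair u v → v ≤ u → 0 < B ∧ ∀ r t, 0 ≤ r → r < t →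
        concPair (r * t * u) (r ^ 2 * v) < A * r ^ 2 + B * t ^ 2) := by
  rcases le_or_gt v u with h | h
  · rcases hu.eq_or_lt with rfl | hu
    · have : v = 0 := le_antisymm h hv
      subst this
      refine ⟨0, 0, le_rfl, le_rfl, ?_, ?_, ?_⟩ <;> simp [concPair]
    · have hB : 0 < u / 2 - v ^ 2 / (6 * u) := by
        rw [sub_pos, div_lt_div_iff₀ (by positivity) (by positivity)]
        nlinarith [pow_pos hu 2]
      refine ⟨u / 2 + v ^ 2 / (2 * u), u / 2 - v ^ 2 / (6 * u), by positivity, hB.le, ?_, ?_, ?_⟩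
      · rw [concPair_of_le h]; field_simp; ring
      · exact fun r t hr ht => concPair_measure_of_le hu hv h hr ht
      · exact fun _ _ => ⟨hB, fun r t hr ht => concPair_measure_lt hu hv h hr ht⟩
  · have hv0 : 0 < v := hu.trans_lt h
    refine ⟨v, u ^ 2 / (3 * v), hv, by positivity, (concPair_of_ge h.le).symm, ?_, ?_⟩
    · exact fun r t hr ht => concPair_measure_of_ge hu hv0 h.le hr ht
    · exact fun _ h' => absurd h' (not_le.mpr h)

/-! ## Two-by-two matrices -/

/-- This is the QR decomposition; the first column of `V` is the normalized first column of `M`. -/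
theorem exists_unitary_mul_triangular (M : Matrix (Fin 2) (Fin 2) ℂ) :
    ∃ V ∈ Matrix.unitaryGroup (Fin 2) ℂ, ∃ T : Matrix (Fin 2) (Fin 2) ℂ,
      T 1 0 = 0 ∧ M = V * T := by
  by_cases h : M 1 0 = 0
  · exact ⟨1, one_mem _, M, h, (one_mul M).symm⟩
  set a := M 0 0
  set b := M 1 0
  set n : ℝ := √(‖a‖ ^ 2 + ‖b‖ ^ 2) with hn
  have hb : 0 < ‖b‖ := norm_pos_iff.mpr h
  have hpos : 0 < ‖a‖ ^ 2 + ‖b‖ ^ 2 := by positivity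
  have hn0 : (n : ℂ) ≠ 0 := by
    rw [Complex.ofReal_ne_zero]; exact (Real.sqrt_pos.mpr hpos).ne'
  have hn2 : (n : ℂ) ^ 2 = a * star a + b * star b := by
    have : n ^ 2 = ‖a‖ ^ 2 + ‖b‖ ^ 2 := Real.sq_sqrt hpos.le
    have h2 : ((n ^ 2 : ℝ) : ℂ) = ((‖a‖ ^ 2 + ‖b‖ ^ 2 : ℝ) : ℂ) := by rw [this]
    push_cast at h2
    rw [h2, ← Complex.mul_conj', ← Complex.mul_conj']; rfl
  let V : Matrix (Fin 2) (Fin 2) ℂ := !![a / n, -star b / n; b / n, star a / n]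
  have hV : V ∈ Matrix.unitaryGroup (Fin 2) ℂ := by
    rw [Matrix.mem_unitaryGroup_iff']
    have hs : star (n : ℂ) = n := Complex.conj_ofReal n
    ext i j
    fin_cases i <;> fin_cases j <;>
    simp [V, Matrix.mul_apply, Fin.sum_univ_two, Matrix.star_apply] <;>
    field_simp <;> (try rw [hn2]) <;> simp <;> ring
  refine ⟨V, hV, star V * M, ?_, ?_⟩
  · simp [V, Matrix.mul_apply, Fin.sum_univ_two, Matrix.star_apply]
    field_simp
    change -(b * a) + a * b = _ * 0
    ring
  · rw [← mul_assoc, Matrix.mem_unitaryGroup_iff.mp hV, one_mul]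

/-- `M` is a multiple of a unitary. -/
def IsUnitaryMultiple (M : Matrix (Fin 2) (Fin 2) ℂ) : Prop :=
  ∃ (c : ℂ) (U : Matrix (Fin 2) (Fin 2) ℂ), U ∈ Matrix.unitaryGroup (Fin 2) ℂ ∧ M = c • U

open scoped ComplexOrder in
theorem isUnitaryMultiple_of_conjTranspose_mul {M : Matrix (Fin 2) (Fin 2) ℂ} {r : ℝ}
    (h : M.conjTranspose * M = ((r ^ 2 : ℝ) : ℂ) • 1) : IsUnitaryMultiple M := by
  rcases eq_or_ne r 0 with rfl | hr
  · refine ⟨0, 1, one_mem _, ?_⟩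
    rw [zero_smul]
    apply Matrix.conjTranspose_mul_self_eq_zero.mp
    rw [h]; simp
  · have hr' : (r : ℂ) ≠ 0 := Complex.ofReal_ne_zero.mpr hr
    refine ⟨r, (r : ℂ)⁻¹ • M, ?_, ?_⟩
    · rw [Matrix.mem_unitaryGroup_iff', star_smul, Matrix.star_eq_conjTranspose, smul_mul_smul_comm,
        h, smul_smul]
      have : star (r : ℂ)⁻¹ * (r : ℂ)⁻¹ * ((r ^ 2 : ℝ) : ℂ) = 1 := by
        simp; field_simp
      rw [this, one_smul]
    · rw [smul_smul, mul_inv_cancel₀ hr', one_smul]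

theorem IsUnitaryMultiple.exists_sqNorm {M : Matrix (Fin 2) (Fin 2) ℂ} (h : IsUnitaryMultiple M) :
    ∃ r : ℝ, ∀ v, sqNorm (M.mulVec v) = r * sqNorm v := by
  obtain ⟨c, U, hU, rfl⟩ := h
  refine ⟨‖c‖ ^ 2, fun v => ?_⟩
  rw [Matrix.smul_mulVec, sqNorm_smul, sqNorm_unitary (Matrix.mem_unitaryGroup_iff'.mp hU)]

theorem sqNorm_mulVec_single (T : Matrix (Fin 2) (Fin 2) ℂ) (a : Fin 2) :
    sqNorm (T.mulVec (Pi.single a 1)) = ‖T 0 a‖ ^ 2 + ‖T 1 a‖ ^ 2 := by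
  simp [sqNorm, Fin.sum_univ_two, Matrix.mulVec_single]

theorem isUnitaryMultiple_of_diagonal {T : Matrix (Fin 2) (Fin 2) ℂ} (h10 : T 1 0 = 0)
    (h01 : T 0 1 = 0) (h : ‖T 0 0‖ = ‖T 1 1‖) :
    T.conjTranspose * T = ((‖T 0 0‖ ^ 2 : ℝ) : ℂ) • 1 := by
  ext i j
  fin_cases i <;> fin_cases j <;>
    simp [Matrix.mul_apply, Fin.sum_univ_two, h10, h01, Complex.conj_mul', h]

/-! ## The cone over the W class -/

/-- The cone over the W class: the vectors that are locally unitarily equivalent to some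
`c₀|000⟩ + c_A|100⟩ + c_B|010⟩ + c_C|001⟩`. -/
def IsWCone (ξ : Bits → ℂ) : Prop :=
  ∃ U : Fin 3 → Matrix (Fin 2) (Fin 2) ℂ, (∀ J, U J ∈ Matrix.unitaryGroup (Fin 2) ℂ) ∧
    ∃ (c₀ : ℂ) (c : Fin 3 → ℂ), ξ = (tensorOp U).mulVec (wVec c₀ c)

theorem IsWCone.smul {ξ : Bits → ℂ} (h : IsWCone ξ) (a : ℂ) : IsWCone (a • ξ) := by
  obtain ⟨U, hU, c₀, c, rfl⟩ := h
  exact ⟨U, hU, a * c₀, a • c, by rw [← smul_wVec, Matrix.mulVec_smul]⟩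

theorem exists_phase (c : ℂ) : ∃ z : ℂ, ‖z‖ = 1 ∧ c = z * ‖c‖ := by
  rcases eq_or_ne c 0 with rfl | h
  · exact ⟨1, by simp, by simp⟩
  · have h' : (‖c‖ : ℂ) ≠ 0 := by simpa using h
    refine ⟨c / ‖c‖, ?_, by field_simp⟩
    rw [norm_div, Complex.norm_real, norm_norm, div_self (by simpa using h)]

theorem IsWCone.isWClass {ξ : Bits → ℂ} (h : IsWCone ξ) (h1 : sqNorm ξ = 1) : IsWClass ξ := by
  obtain ⟨U, hU, c₀, c, rfl⟩ := h
  rw [sqNorm_unitary (tensorOp_unitary hU), sqNorm_wVec] at h1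
  obtain ⟨z₀, hz₀, e₀⟩ := exists_phase c₀
  choose z hz e using fun K => exists_phase (c K)
  have hz₀' : star z₀ * z₀ = 1 := by
    have := Complex.conj_mul' z₀
    rw [hz₀] at this; simpa using this
  -- The phase of `c₀` is a global phase, carried by party 0 alone; the phase of `c K` relative to
  -- it is produced on the excited level of party `K`.
  let D : Fin 3 → Matrix (Fin 2) (Fin 2) ℂ := fun K =>
    (if K = 0 then z₀ else 1) • Matrix.diagonal ![1, z K * star z₀]
  have hD : ∀ K, D K ∈ Matrix.unitaryGroup (Fin 2) ℂ := by
    intro K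
    have n0 : ‖(if K = 0 then z₀ else 1 : ℂ)‖ = 1 := by split_ifs <;> simp [hz₀]
    rw [Matrix.mem_unitaryGroup_iff', star_smul, smul_mul_smul_comm, Matrix.star_eq_conjTranspose]
    have n1 : star (if K = 0 then z₀ else 1 : ℂ) * (if K = 0 then z₀ else 1 : ℂ) = 1 := by
      have := Complex.conj_mul' (if K = 0 then z₀ else 1 : ℂ)
      rw [n0] at this; simpa using this
    rw [n1, one_smul]
    have n2 : star (z K * star z₀) * (z K * star z₀) = 1 := by
      have := Complex.conj_mul' (z K * star z₀)
      rw [norm_mul, norm_star, hz₀, hz] at this; simpa using this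
    ext i j
    fin_cases i <;> fin_cases j <;> simp [Matrix.diagonal_conjTranspose]
    simpa using n2
  refine ⟨fun K => ‖c K‖ ^ 2, fun K => sq_nonneg _, ?_, fun J => U J * D J,
    fun J => mul_mem (hU J) (hD J), ?_⟩
  · nlinarith [sq_nonneg ‖c₀‖]
  · rw [← tensorOp_mul, ← Matrix.mulVec_mulVec]
    congr 1
    have hc₀ : √(1 - ∑ K, ‖c K‖ ^ 2) = ‖c₀‖ := by
      rw [← h1, add_sub_cancel_right, Real.sqrt_sq (norm_nonneg _)]
    rw [wKet_eq_wVec, hc₀]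
    simp only [Real.sqrt_sq (norm_nonneg _)]
    have hD' : tensorOp D = z₀ • (localOp 0 (Matrix.diagonal ![1, z 0 * star z₀]) *
        (localOp 1 (Matrix.diagonal ![1, z 1 * star z₀]) *
          localOp 2 (Matrix.diagonal ![1, z 2 * star z₀]))) := by
      have h1 : tensorOp D = z₀ • tensorOp fun K => Matrix.diagonal ![1, z K * star z₀] := by
        ext s t
        simp only [tensorOp, D, Fin.prod_univ_three, Matrix.of_apply, Matrix.smul_apply,
          smul_eq_mul]
        simp [mul_assoc]
      rw [h1, localOp, localOp, localOp, tensorOp_mul, tensorOp_mul]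
      congr 2
      ext1 J
      fin_cases J <;> simp
    rw [hD', Matrix.smul_mulVec, ← Matrix.mulVec_mulVec, ← Matrix.mulVec_mulVec,
      localOp_mulVec_wVec _ _ (by simp), localOp_mulVec_wVec _ _ (by simp),
      localOp_mulVec_wVec _ _ (by simp), smul_wVec]
    have hc : ∀ K, z₀ * (z K * star z₀ * ‖c K‖) = c K := by
      intro K
      conv_rhs => rw [e K]
      linear_combination (z K * ‖c K‖) * hz₀'
    congr 1
    · simp [← e₀]
    · ext K
      have := hc K
      fin_cases K <;> simpa using this.symm

theorem HasWParams.isWCone {ψ : Bits → ℂ} {x : Fin 3 → ℝ} (h : HasWParams ψ x) : IsWCone ψ := by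
  obtain ⟨_, _, U, hU, rfl⟩ := h
  exact ⟨U, hU, _, _, by rw [wKet_eq_wVec]⟩

theorem HasWParams.sqNorm_eq_one {ψ : Bits → ℂ} {x : Fin 3 → ℝ} (h : HasWParams ψ x) :
    sqNorm ψ = 1 := by
  obtain ⟨h0, h1, U, hU, rfl⟩ := h
  rw [sqNorm_unitary (tensorOp_unitary hU), wKet_eq_wVec, sqNorm_wVec]
  simp only [Complex.norm_real, Real.norm_eq_abs, sq_abs]
  rw [Real.sq_sqrt (by linarith)]
  simp only [Real.sq_sqrt (h0 _)]
  ring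

/-! ## The function `𝒞` on the cone -/

/-- The concurrence of the reduced state of `⋆` and `⋆ + 1`, for states of the W class. -/
def concFst (star : Fin 3) (ξ : Bits → ℂ) : ℝ :=
  √(2 * (redDet star (ketbra ξ) + redDet (star + 1) (ketbra ξ) - redDet (star + 2) (ketbra ξ)))

/-- The concurrence of the reduced state of `⋆` and `⋆ + 2`, for states of the W class. -/
def concSnd (star : Fin 3) (ξ : Bits → ℂ) : ℝ :=
  √(2 * (redDet star (ketbra ξ) + redDet (star + 2) (ketbra ξ) - redDet (star + 1) (ketbra ξ)))

/-- The homogeneous extension of `𝒞` to the cone over the W class. -/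
def conc (star : Fin 3) (ξ : Bits → ℂ) : ℝ := concPair (concFst star ξ) (concSnd star ξ)

theorem concFst_nonneg (star : Fin 3) (ξ : Bits → ℂ) : 0 ≤ concFst star ξ := Real.sqrt_nonneg _

theorem concSnd_nonneg (star : Fin 3) (ξ : Bits → ℂ) : 0 ≤ concSnd star ξ := Real.sqrt_nonneg _

theorem conc_nonneg (star : Fin 3) (ξ : Bits → ℂ) : 0 ≤ conc star ξ :=
  concPair_nonneg (concFst_nonneg star ξ)

/-- In the combination D_⋆ + D_{⋆+1} - D_{⋆+2} of reduced determinants every product of two weights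
cancels except 2|c_⋆|²|c_{⋆+1}|². -/
theorem concFst_wVec (star : Fin 3) {U : Fin 3 → Matrix (Fin 2) (Fin 2) ℂ}
    (hU : ∀ J, U J ∈ Matrix.unitaryGroup (Fin 2) ℂ) (c₀ : ℂ) (c : Fin 3 → ℂ) :
    concFst star ((tensorOp U).mulVec (wVec c₀ c)) = 2 * (‖c star‖ * ‖c (star + 1)‖) := by
  simp only [concFst, ← conjMap_ketbra, redDet_conjMap_tensorOp _ hU, redDet_wVec]
  rw [← Real.sqrt_sq (show 0 ≤ 2 * (‖c star‖ * ‖c (star + 1)‖) by positivity)]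
  congr 1
  fin_cases star <;> simp <;> ring

theorem concSnd_wVec (star : Fin 3) {U : Fin 3 → Matrix (Fin 2) (Fin 2) ℂ}
    (hU : ∀ J, U J ∈ Matrix.unitaryGroup (Fin 2) ℂ) (c₀ : ℂ) (c : Fin 3 → ℂ) :
    concSnd star ((tensorOp U).mulVec (wVec c₀ c)) = 2 * (‖c star‖ * ‖c (star + 2)‖) := by
  simp only [concSnd, ← conjMap_ketbra, redDet_conjMap_tensorOp _ hU, redDet_wVec]
  rw [← Real.sqrt_sq (show 0 ≤ 2 * (‖c star‖ * ‖c (star + 2)‖) by positivity)]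
  congr 1
  fin_cases star <;> simp <;> ring

theorem conc_eq_of_ketbra_eq (star : Fin 3) {ξ η : Bits → ℂ} (h : ketbra ξ = ketbra η) :
    conc star ξ = conc star η := by
  simp only [conc, concFst, concSnd, h]

theorem conc_smul (star : Fin 3) (a : ℂ) (ξ : Bits → ℂ) :
    conc star (a • ξ) = ‖a‖ ^ 2 * conc star ξ := by
  have h : ∀ d₁ d₂ d₃ r : ℝ, √(2 * ((r ^ 2) ^ 2 * d₁ + (r ^ 2) ^ 2 * d₂ - (r ^ 2) ^ 2 * d₃))
      = r ^ 2 * √(2 * (d₁ + d₂ - d₃)) := by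
    intro d₁ d₂ d₃ r
    rw [show 2 * ((r ^ 2) ^ 2 * d₁ + (r ^ 2) ^ 2 * d₂ - (r ^ 2) ^ 2 * d₃)
      = (r ^ 2) ^ 2 * (2 * (d₁ + d₂ - d₃)) by ring, Real.sqrt_mul (by positivity),
      Real.sqrt_sq (by positivity)]
  simp only [conc, concFst, concSnd, ketbra_smul, redDet_smul, h]
  rw [concPair_mul (by positivity)]

theorem HasWParams.concFst_eq {ψ : Bits → ℂ} {x : Fin 3 → ℝ} (h : HasWParams ψ x) (star : Fin 3) :
    concFst star ψ = 2 * (√(x star) * √(x (star + 1))) := by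
  obtain ⟨h0, h1, U, hU, rfl⟩ := h
  rw [wKet_eq_wVec, concFst_wVec star hU]
  simp [abs_of_nonneg (Real.sqrt_nonneg _)]

theorem HasWParams.concSnd_eq {ψ : Bits → ℂ} {x : Fin 3 → ℝ} (h : HasWParams ψ x) (star : Fin 3) :
    concSnd star ψ = 2 * (√(x star) * √(x (star + 2))) := by
  obtain ⟨h0, h1, U, hU, rfl⟩ := h
  rw [wKet_eq_wVec, concSnd_wVec star hU]
  simp [abs_of_nonneg (Real.sqrt_nonneg _)]

theorem concPair_sqrt {a p q : ℝ} (ha : 0 ≤ a) (hp : 0 ≤ p) (hqp : q ≤ p) (hq : 0 ≤ q) :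
    concPair (2 * (√a * √p)) (2 * (√a * √q))
      = if p ≠ 0 then 2 * √(a * p) + 2 / 3 * q * √(a / p) else 0 := by
  have hle : 2 * (√a * √q) ≤ 2 * (√a * √p) := by
    have := Real.sqrt_le_sqrt hqp
    gcongr
  rw [concPair_of_le hle]
  rcases hp.eq_or_lt with rfl | hp'
  -- When `p` vanishes so does `q`; since division by zero is zero, `concPair` then also takes the
  -- value prescribed by the second case of `concFun`.
  · have : q = 0 := le_antisymm hqp hq
    subst this; simp
  rw [if_pos hp'.ne', Real.sqrt_mul ha, Real.sqrt_div ha]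
  rcases ha.eq_or_lt with rfl | ha'
  · simp
  have h1 := Real.sqrt_pos.mpr hp'
  have h2 := Real.sqrt_pos.mpr ha'
  have h3 := Real.sq_sqrt hq
  field_simp
  rw [h3]

theorem HasWParams.concFun_eq {ψ : Bits → ℂ} {x : Fin 3 → ℝ} (h : HasWParams ψ x) (star : Fin 3) :
    concFun star x = conc star ψ := by
  rw [conc, h.concFst_eq, h.concSnd_eq, concFun]
  rcases le_total (x (star + 2)) (x (star + 1)) with hle | hle
  · rw [max_eq_left hle, min_eq_right hle, concPair_sqrt (h.1 _) (h.1 _) hle (h.1 _)]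
  · rw [max_eq_right hle, min_eq_left hle, concPair_comm,
      concPair_sqrt (h.1 _) (h.1 _) hle (h.1 _)]

/-! ## Local operations on the cone -/

/-- Party `K` is `⋆`, or its concurrence with `⋆` is the larger of the two. -/
def IsStrictParty (star K : Fin 3) (ξ : Bits → ℂ) : Prop :=
  K = star ∨ K = star + 1 ∧ concSnd star ξ ≤ concFst star ξ ∨
    K = star + 2 ∧ concFst star ξ ≤ concSnd star ξ

theorem fin_three_add_ne (a : Fin 3) : a + 1 ≠ a ∧ a + 2 ≠ a ∧ a + 2 ≠ a + 1 := by
  revert a; decide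

theorem fin_three_cases (a b : Fin 3) : b = a ∨ b = a + 1 ∨ b = a + 2 := by
  revert a b; decide

theorem concFst_triangular {U V : Fin 3 → Matrix (Fin 2) (Fin 2) ℂ}
    (hU : ∀ J, U J ∈ Matrix.unitaryGroup (Fin 2) ℂ)
    (hV : ∀ J, V J ∈ Matrix.unitaryGroup (Fin 2) ℂ) {T : Matrix (Fin 2) (Fin 2) ℂ}
    (hT : T 1 0 = 0) (star : Fin 3) (c₀ : ℂ) (c : Fin 3 → ℂ) (K : Fin 3) :
    concFst star ((tensorOp V).mulVec ((localOp K T).mulVec (wVec c₀ c)))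
      = (if K = star + 2 then ‖T 0 0‖ ^ 2 else ‖T 0 0‖ * ‖T 1 1‖)
        * concFst star ((tensorOp U).mulVec (wVec c₀ c)) := by
  obtain ⟨ne1, ne2, ne3⟩ := fin_three_add_ne star
  rw [localOp_mulVec_wVec _ T hT, concFst_wVec star hV, concFst_wVec star hU]
  rcases fin_three_cases star K with rfl | rfl | rfl
  · simp only [ne1, ne2.symm, if_true, if_false, norm_mul]; ring
  · simp only [ne1.symm, ne3.symm, if_true, if_false, norm_mul]; ring
  · simp only [ne2.symm, ne3.symm, if_true, if_false, norm_mul]; ring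

theorem concSnd_triangular {U V : Fin 3 → Matrix (Fin 2) (Fin 2) ℂ}
    (hU : ∀ J, U J ∈ Matrix.unitaryGroup (Fin 2) ℂ)
    (hV : ∀ J, V J ∈ Matrix.unitaryGroup (Fin 2) ℂ) {T : Matrix (Fin 2) (Fin 2) ℂ}
    (hT : T 1 0 = 0) (star : Fin 3) (c₀ : ℂ) (c : Fin 3 → ℂ) (K : Fin 3) :
    concSnd star ((tensorOp V).mulVec ((localOp K T).mulVec (wVec c₀ c)))
      = (if K = star + 1 then ‖T 0 0‖ ^ 2 else ‖T 0 0‖ * ‖T 1 1‖)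
        * concSnd star ((tensorOp U).mulVec (wVec c₀ c)) := by
  obtain ⟨ne1, ne2, ne3⟩ := fin_three_add_ne star
  rw [localOp_mulVec_wVec _ T hT, concSnd_wVec star hV, concSnd_wVec star hU]
  rcases fin_three_cases star K with rfl | rfl | rfl
  · simp only [ne1.symm, ne2, if_true, if_false, norm_mul]; ring
  · simp only [ne1.symm, ne3, if_true, if_false, norm_mul]; ring
  · simp only [ne2.symm, ne3, if_true, if_false, norm_mul]; ring

/-- A measurement by `⋆` multiplies both concurrences by r t, so the arithmetic-geometric mean
inequality suffices. A measurement by another party multiplies its own concurrence with `⋆` by r t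
and the other one by r², which is the situation of `exists_concPair_measure`. The weights depend
neither on `T` nor on `V`, so that the bound can be summed over outcomes. -/
theorem exists_triangular_bound (star K : Fin 3) {U : Fin 3 → Matrix (Fin 2) (Fin 2) ℂ}
    (hU : ∀ J, U J ∈ Matrix.unitaryGroup (Fin 2) ℂ) (c₀ : ℂ) (c : Fin 3 → ℂ) :
    ∃ A B : ℝ, 0 ≤ A ∧ 0 ≤ B ∧ A + B = conc star ((tensorOp U).mulVec (wVec c₀ c)) ∧
      ∀ (V : Fin 3 → Matrix (Fin 2) (Fin 2) ℂ), (∀ J, V J ∈ Matrix.unitaryGroup (Fin 2) ℂ) →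
      ∀ T : Matrix (Fin 2) (Fin 2) ℂ, T 1 0 = 0 →
        conc star ((tensorOp V).mulVec ((localOp K T).mulVec (wVec c₀ c)))
          ≤ A * ‖T 0 0‖ ^ 2 + B * ‖T 1 1‖ ^ 2 ∧
        (0 < conc star ((tensorOp U).mulVec (wVec c₀ c)) →
          IsStrictParty star K ((tensorOp U).mulVec (wVec c₀ c)) → 0 < B ∧
          (‖T 0 0‖ < ‖T 1 1‖ → conc star ((tensorOp V).mulVec ((localOp K T).mulVec (wVec c₀ c)))
            < A * ‖T 0 0‖ ^ 2 + B * ‖T 1 1‖ ^ 2)) := by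
  obtain ⟨ne1, ne2, ne3⟩ := fin_three_add_ne star
  have hu := concFst_nonneg star ((tensorOp U).mulVec (wVec c₀ c))
  have hv := concSnd_nonneg star ((tensorOp U).mulVec (wVec c₀ c))
  have key := fun (V : Fin 3 → Matrix (Fin 2) (Fin 2) ℂ)
    (hV : ∀ J, V J ∈ Matrix.unitaryGroup (Fin 2) ℂ) (T : Matrix (Fin 2) (Fin 2) ℂ)
    (hT : T 1 0 = 0) => And.intro (concFst_triangular hU hV hT star c₀ c K)
      (concSnd_triangular hU hV hT star c₀ c K)
  simp only [conc, IsStrictParty] at *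
  generalize concFst star ((tensorOp U).mulVec (wVec c₀ c)) = u at *
  generalize concSnd star ((tensorOp U).mulVec (wVec c₀ c)) = v at *
  rcases fin_three_cases star K with h | h | h
  · have hc := concPair_nonneg (v := v) hu
    refine ⟨concPair u v / 2, concPair u v / 2, by positivity, by positivity, by ring,
      fun V hV T hT => ?_⟩
    obtain ⟨e1, e2⟩ := key V hV T hT
    rw [h, if_neg ne2.symm] at e1
    rw [h, if_neg ne1.symm] at e2
    rw [h, e1, e2, concPair_mul (by positivity)]
    refine ⟨by nlinarith [sq_nonneg (‖T 0 0‖ - ‖T 1 1‖)], fun hpos _ => ⟨by positivity, ?_⟩⟩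
    intro hlt
    nlinarith [mul_pos hpos (pow_pos (sub_pos.mpr hlt) 2)]
  · obtain ⟨A, B, hA, hB, hAB, hle, hst⟩ := exists_concPair_measure hu hv
    refine ⟨A, B, hA, hB, hAB, fun V hV T hT => ?_⟩
    obtain ⟨e1, e2⟩ := key V hV T hT
    rw [h, if_neg ne3.symm] at e1
    rw [h, if_pos rfl] at e2
    rw [h, e1, e2]
    refine ⟨hle _ _ (norm_nonneg _) (norm_nonneg _), fun hpos hs => ?_⟩
    have hs' : v ≤ u := by
      rcases hs with h | h | h
      · exact absurd h ne1
      · exact h.2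
      · exact absurd h.1.symm ne3
    exact ⟨(hst hpos hs').1, (hst hpos hs').2 _ _ (norm_nonneg _)⟩
  · obtain ⟨A, B, hA, hB, hAB, hle, hst⟩ := exists_concPair_measure hv hu
    rw [concPair_comm] at hAB hst
    refine ⟨A, B, hA, hB, hAB, fun V hV T hT => ?_⟩
    obtain ⟨e1, e2⟩ := key V hV T hT
    rw [h, if_pos rfl] at e1
    rw [h, if_neg ne3] at e2
    rw [h, e1, e2, concPair_comm (‖T 0 0‖ ^ 2 * u)]
    refine ⟨hle _ _ (norm_nonneg _) (norm_nonneg _), fun hpos hs => ?_⟩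
    have hs' : u ≤ v := by
      rcases hs with h | h | h
      · exact absurd h ne2
      · exact absurd h.1 ne3
      · exact h.2
    exact ⟨(hst hpos hs').1, (hst hpos hs').2 _ _ (norm_nonneg _)⟩

/-- The unit vectors are the columns of U_K, chosen before `M`. Writing M U_K = V T, their images
have squared norms |T₀₀|² and |T₀₁|² + |T₁₁|², so the bound for `T` carries over with a surplus B
|T₀₁|². -/
theorem IsWCone.exists_local_bound (star K : Fin 3) {ξ : Bits → ℂ} (hξ : IsWCone ξ) :
    ∃ (v₀ v₁ : Fin 2 → ℂ) (A B : ℝ), sqNorm v₀ = 1 ∧ sqNorm v₁ = 1 ∧ 0 ≤ A ∧ 0 ≤ B ∧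
      A + B = conc star ξ ∧ ∀ M : Matrix (Fin 2) (Fin 2) ℂ,
        IsWCone ((localOp K M).mulVec ξ) ∧
        conc star ((localOp K M).mulVec ξ) ≤ A * sqNorm (M.mulVec v₀) + B * sqNorm (M.mulVec v₁) ∧
        (0 < conc star ξ → IsStrictParty star K ξ → ¬ IsUnitaryMultiple M →
          sqNorm (M.mulVec v₀) ≤ sqNorm (M.mulVec v₁) → conc star ((localOp K M).mulVec ξ)
            < A * sqNorm (M.mulVec v₀) + B * sqNorm (M.mulVec v₁)) := by
  obtain ⟨U, hU, c₀, c, rfl⟩ := hξ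
  obtain ⟨A, B, hA, hB, hAB, hbound⟩ := exists_triangular_bound star K hU c₀ c
  have hUK : (U K).conjTranspose * U K = 1 := Matrix.mem_unitaryGroup_iff'.mp (hU K)
  have hUK' : U K * (U K).conjTranspose = 1 := Matrix.mem_unitaryGroup_iff.mp (hU K)
  refine ⟨(U K).mulVec (Pi.single 0 1), (U K).mulVec (Pi.single 1 1), A, B, ?_, ?_, hA, hB, hAB,
    fun M => ?_⟩
  · rw [sqNorm_unitary hUK]; simp [sqNorm]
  · rw [sqNorm_unitary hUK]; simp [sqNorm]
  obtain ⟨V, hV, T, hT, hMT⟩ := exists_unitary_mul_triangular (M * U K)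
  have hVV : V.conjTranspose * V = 1 := Matrix.mem_unitaryGroup_iff'.mp hV
  have hW : ∀ J, Function.update U K V J ∈ Matrix.unitaryGroup (Fin 2) ℂ := by
    intro J
    by_cases h : J = K
    · subst h; simpa using hV
    · simpa [h] using hU J
  have hM : (localOp K M).mulVec ((tensorOp U).mulVec (wVec c₀ c))
      = (tensorOp (Function.update U K V)).mulVec ((localOp K T).mulVec (wVec c₀ c)) := by
    rw [Matrix.mulVec_mulVec, Matrix.mulVec_mulVec, localOp_mul_tensorOp, tensorOp_mul_localOp,
      Function.update_self, Function.update_idem, hMT]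
  have e0 : sqNorm (M.mulVec ((U K).mulVec (Pi.single 0 1))) = ‖T 0 0‖ ^ 2 := by
    rw [Matrix.mulVec_mulVec, hMT, ← Matrix.mulVec_mulVec, sqNorm_unitary hVV,
      sqNorm_mulVec_single, hT]
    simp
  have e1 : sqNorm (M.mulVec ((U K).mulVec (Pi.single 1 1))) = ‖T 0 1‖ ^ 2 + ‖T 1 1‖ ^ 2 := by
    rw [Matrix.mulVec_mulVec, hMT, ← Matrix.mulVec_mulVec, sqNorm_unitary hVV,
      sqNorm_mulVec_single]
  obtain ⟨hle, hlt⟩ := hbound _ hW T hT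
  rw [hM, e0, e1]
  refine ⟨⟨_, hW, _, _, by rw [localOp_mulVec_wVec K T hT]⟩, ?_, fun hpos hs hne h01 => ?_⟩
  · have := mul_nonneg hB (sq_nonneg ‖T 0 1‖)
    linarith
  · obtain ⟨hBpos, hstrict⟩ := hlt hpos hs
    -- If `T 0 1` is nonzero, the surplus is already positive. Otherwise `T` is diagonal, and equal
    -- moduli on the diagonal would make `M` a multiple of a unitary, so the strict tangent-plane
    -- bound applies.
    rcases eq_or_ne (T 0 1) 0 with h | h
    · rw [h] at h01 ⊢
      have hle' : ‖T 0 0‖ ≤ ‖T 1 1‖ := by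
        have : ‖T 0 0‖ ^ 2 ≤ ‖T 1 1‖ ^ 2 := by simpa using h01
        exact (sq_le_sq₀ (norm_nonneg _) (norm_nonneg _)).mp this
      rcases hle'.eq_or_lt with heq | hlt'
      · refine absurd ?_ hne
        apply isUnitaryMultiple_of_conjTranspose_mul (r := ‖T 0 0‖)
        have hMM : M = V * T * (U K).conjTranspose := by
          rw [← hMT, mul_assoc, hUK', mul_one]
        have : M.conjTranspose * M = U K * (T.conjTranspose * (V.conjTranspose * V) * T) *
            (U K).conjTranspose := by
          rw [hMM]
          simp only [Matrix.conjTranspose_mul, Matrix.conjTranspose_conjTranspose, mul_assoc]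
        rw [this, hVV, mul_one, isUnitaryMultiple_of_diagonal hT h heq, Matrix.mul_smul, mul_one,
          Matrix.smul_mul, hUK']
      · simpa using hstrict hlt'
    · have : 0 < B * ‖T 0 1‖ ^ 2 := by
        have := norm_pos_iff.mpr h
        positivity
      linarith

theorem IsWCone.localOp {ξ : Bits → ℂ} (hξ : IsWCone ξ) (K : Fin 3)
    (M : Matrix (Fin 2) (Fin 2) ℂ) : IsWCone ((localOp K M).mulVec ξ) := by
  obtain ⟨_, _, _, _, _, _, _, _, _, h⟩ := hξ.exists_local_bound 0 K
  exact (h M).1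

/-! ## Strict decrease under measurements -/

theorem IsMeasurement.hasSum_sqNorm {Θ : Type} {M : Θ → Matrix (Fin 2) (Fin 2) ℂ}
    (hM : IsMeasurement M) (v : Fin 2 → ℂ) :
    HasSum (fun j => sqNorm ((M j).mulVec v)) (sqNorm v) := by
  let L : Matrix (Fin 2) (Fin 2) ℂ →ₗ[ℂ] ℂ :=
    { toFun := fun N => star v ⬝ᵥ N.mulVec v
      map_add' := fun a b => by rw [Matrix.add_mulVec, dotProduct_add]
      map_smul' := fun c a => by rw [Matrix.smul_mulVec, dotProduct_smul, RingHom.id_apply] }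
  have h := hM.map L L.continuous_of_finiteDimensional
  have h2 := Complex.reCLM.hasSum h
  have e : ∀ j, Complex.reCLM ((L ∘ fun j => (M j).conjTranspose * M j) j)
      = sqNorm ((M j).mulVec v) := by
    intro j
    change (star v ⬝ᵥ ((M j).conjTranspose * M j).mulVec v).re = _
    rw [← sqNorm_mulVec, Complex.ofReal_re]
  have e1 : Complex.reCLM (L 1) = sqNorm v := by
    change (star v ⬝ᵥ (1 : Matrix (Fin 2) (Fin 2) ℂ).mulVec v).re = _
    rw [Matrix.one_mulVec, star_dotProduct_self, Complex.ofReal_re]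
  rw [e1] at h2
  exact (funext e) ▸ h2

theorem IsWCone.tsum_conc_measurement_lt {star K : Fin 3} {ξ : Bits → ℂ} (hξ : IsWCone ξ)
    (hpos : 0 < conc star ξ) (hs : IsStrictParty star K ξ) {Θ : Type}
    {M : Θ → Matrix (Fin 2) (Fin 2) ℂ} (hM : IsMeasurement M) (hnt : ¬ IsTrivialMeasurement M) :
    Summable (fun j => conc star ((_root_.localOp K (M j)).mulVec ξ)) ∧
      ∑' j, conc star ((_root_.localOp K (M j)).mulVec ξ) < conc star ξ := by
  obtain ⟨v₀, v₁, A, B, h0, h1, hA, hB, hAB, h⟩ := hξ.exists_local_bound star K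
  have s0 := hM.hasSum_sqNorm v₀
  have s1 := hM.hasSum_sqNorm v₁
  have s := (s0.mul_left A).add (s1.mul_left B)
  rw [h0, h1, mul_one, mul_one, hAB] at s
  have hsum : Summable (fun j => conc star ((_root_.localOp K (M j)).mulVec ξ)) :=
    Summable.of_nonneg_of_le (fun j => conc_nonneg _ _) (fun j => (h (M j)).2.1) s.summable
  refine ⟨hsum, ?_⟩
  -- Strictness is available only for outcomes that do not favour `v₀`. If every outcome that is not
  -- a unitary multiple favoured `v₀` strictly, the total weights of `v₀` and `v₁`, both equal to 1,
  -- would differ.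
  have hex : ∃ i, ¬ IsUnitaryMultiple (M i) ∧
      sqNorm ((M i).mulVec v₀) ≤ sqNorm ((M i).mulVec v₁) := by
    obtain ⟨i, hi⟩ := not_forall.mp hnt
    by_cases hle : sqNorm ((M i).mulVec v₀) ≤ sqNorm ((M i).mulVec v₁)
    · exact ⟨i, hi, hle⟩
    by_contra hno
    push Not at hno
    have hall : ∀ j, sqNorm ((M j).mulVec v₁) ≤ sqNorm ((M j).mulVec v₀) := by
      intro j
      by_cases hj : IsUnitaryMultiple (M j)
      · obtain ⟨r, hr⟩ := hj.exists_sqNorm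
        rw [hr, hr, h0, h1]
      · exact (hno j hj).le
    have := hasSum_lt hall (not_le.mp hle) s1 s0
    rw [h0, h1] at this
    exact lt_irrefl _ this
  obtain ⟨i, hi, hle⟩ := hex
  exact hasSum_lt (fun j => (h (M j)).2.1) ((h (M i)).2.2 hpos hs hi hle) hsum.hasSum s

theorem HasWParams.isStrictParty {ψ : Bits → ℂ} {x : Fin 3 → ℝ} (h : HasWParams ψ x)
    {star K : Fin 3} (hK : K = star ∨ IsFirstParty star x K) : IsStrictParty star K ψ := by
  rcases hK with rfl | ⟨hne, hK⟩
  · exact Or.inl rfl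
  obtain ⟨ne1, ne2, -⟩ := fin_three_add_ne star
  have hc := (fin_three_cases star K).resolve_left hne
  rw [IsStrictParty, h.concFst_eq, h.concSnd_eq]
  rcases hc with rfl | rfl
  · have := Real.sqrt_le_sqrt (hK _ ne2)
    exact Or.inr (Or.inl ⟨rfl, by gcongr⟩)
  · have := Real.sqrt_le_sqrt (hK _ ne1)
    exact Or.inr (Or.inr ⟨rfl, by gcongr⟩)

/-- If the output of an outcome is pure, `𝒞` of the output is determined by the unnormalized
vector. -/
theorem conc_of_ketbra_eq (star : Fin 3) {p : ℝ} (hp : 0 ≤ p) {ξ φ : Bits → ℂ}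
    (h : ketbra ξ = (p : ℂ) • ketbra φ) : conc star ξ = p * conc star φ := by
  have h' : ketbra ξ = ketbra (((√p : ℝ) : ℂ) • φ) := by
    rw [ketbra_smul, h, Complex.norm_real, Real.norm_eq_abs, sq_abs, Real.sq_sqrt hp]
  rw [conc_eq_of_ketbra_eq star h', conc_smul, Complex.norm_real, Real.norm_eq_abs, sq_abs,
    Real.sq_sqrt hp]

theorem isWCone_of_ketbra_eq {p : ℝ} (hp : 0 < p) {ξ φ : Bits → ℂ} (hφ : sqNorm φ = 1)
    (h : ketbra ξ = (p : ℂ) • ketbra φ) (hξ : IsWCone ξ) : IsWCone φ := by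
  have h' : ketbra ξ = ketbra (((√p : ℝ) : ℂ) • φ) := by
    rw [ketbra_smul, h, Complex.norm_real, Real.norm_eq_abs, sq_abs, Real.sq_sqrt hp.le]
  have hs : ((√p : ℝ) : ℂ) ≠ 0 := Complex.ofReal_ne_zero.mpr (Real.sqrt_pos.mpr hp).ne'
  have hφ0 : φ ≠ 0 := by
    rintro rfl; simp [sqNorm] at hφ
  obtain ⟨a, ha⟩ := eq_smul_of_ketbra_eq (smul_ne_zero hs hφ0) h'
  have : φ = (((√p : ℝ) : ℂ)⁻¹ * a) • ξ := by
    rw [mul_smul, ← ha, smul_smul, inv_mul_cancel₀ hs, one_smul]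
  rw [this]
  exact hξ.smul _

theorem measurement_decrease (star : Fin 3) {ψ : Bits → ℂ} {x : Fin 3 → ℝ} (hx : HasWParams ψ x)
    (hpos : 0 < concFun star x) {K : Fin 3} (hK : K = star ∨ IsFirstParty star x K) {Θ : Type}
    {M : Θ → Matrix (Fin 2) (Fin 2) ℂ} (hM : IsMeasurement M) (hnt : ¬ IsTrivialMeasurement M)
    {p : Θ → ℝ} {φ : Θ → Bits → ℂ} (hy : YieldsPure (localMeasurement K M) ψ p φ) :
    (∀ j, p j ≠ 0 → IsWClass (φ j)) ∧
      ∀ y : Θ → Fin 3 → ℝ, (∀ j, p j ≠ 0 → HasWParams (φ j) (y j)) →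
        Summable (fun j => p j * concFun star (y j)) ∧
          ∑' j, p j * concFun star (y j) < concFun star x := by
  have hk : ∀ j, ketbra ((localOp K (M j)).mulVec ψ) = (p j : ℂ) • ketbra (φ j) := fun j => by
    rw [← conjMap_ketbra]; exact (hy j).2.2
  constructor
  · intro j hj
    exact (isWCone_of_ketbra_eq (lt_of_le_of_ne (hy j).1 hj.symm) (hy j).2.1 (hk j)
      (hx.isWCone.localOp K (M j))).isWClass (hy j).2.1
  · intro y hy'
    have e : (fun j => p j * concFun star (y j))
        = fun j => conc star ((localOp K (M j)).mulVec ψ) := by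
      ext1 j
      rw [conc_of_ketbra_eq star (hy j).1 (hk j)]
      by_cases hj : p j = 0
      · simp [hj]
      · rw [(hy' j hj).concFun_eq]
    rw [e, hx.concFun_eq]
    rw [hx.concFun_eq] at hpos
    exact hx.isWCone.tsum_conc_measurement_lt hpos (hx.isStrictParty hK) hM hnt

/-! ## Product superoperators -/

theorem tensorMap_apply (Φ : Fin 3 → SuperOp (Fin 2)) (ρ : Matrix Bits Bits ℂ) (s t : Bits) :
    tensorMap Φ ρ s t = ∑ u : Bits, ∑ v : Bits,
      (∏ J, Φ J (Matrix.single (u J) (v J) 1) (s J) (t J)) * ρ u v := rfl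

theorem tensorMap_tensorOp (Φ : Fin 3 → SuperOp (Fin 2)) (σ : Fin 3 → Matrix (Fin 2) (Fin 2) ℂ) :
    tensorMap Φ (tensorOp σ) = tensorOp (fun J => Φ J (σ J)) := by
  ext s t
  have h : ∀ J, Φ J (σ J) (s J) (t J)
      = ∑ a, ∑ b, Φ J (Matrix.single a b 1) (s J) (t J) * σ J a b := by
    intro J
    conv_lhs => rw [Matrix.matrix_eq_sum_single (σ J)]
    simp only [map_sum, Matrix.sum_apply]
    refine Finset.sum_congr rfl fun a _ => Finset.sum_congr rfl fun b _ => ?_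
    have : Matrix.single a b (σ J a b) = σ J a b • Matrix.single a b (1 : ℂ) := by simp
    rw [this, map_smul, Matrix.smul_apply, smul_eq_mul, mul_comm]
  have h' : tensorOp (fun J => Φ J (σ J)) s t = ∏ J, ∑ a, ∑ b,
      Φ J (Matrix.single a b 1) (s J) (t J) * σ J a b := by
    simp only [tensorOp, Matrix.of_apply]
    exact Finset.prod_congr rfl fun J _ => h J
  rw [tensorMap_apply, h', ← sum_bits_prod (fun J a => ∑ b, Φ J (Matrix.single a b 1) (s J) (t J) * σ J a b)]
  refine Finset.sum_congr rfl fun u _ => ?_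
  rw [← sum_bits_prod (fun J b => Φ J (Matrix.single (u J) b 1) (s J) (t J) * σ J (u J) b)]
  refine Finset.sum_congr rfl fun v _ => ?_
  rw [Finset.prod_mul_distrib]
  rfl

theorem single_eq_tensorOp (u v : Bits) :
    Matrix.single u v (1 : ℂ) = tensorOp (fun J => Matrix.single (u J) (v J) 1) := by
  ext s t
  simp only [tensorOp, Matrix.of_apply, Matrix.single_apply]
  rw [Finset.prod_ite_zero]
  simp only [Finset.prod_const_one, Finset.mem_univ, true_implies, funext_iff, forall_and]

/-- Product operators span, since every matrix unit is one. -/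
theorem superOp_ext {Φ Ψ : SuperOp Bits}
    (h : ∀ σ : Fin 3 → Matrix (Fin 2) (Fin 2) ℂ, Φ (tensorOp σ) = Ψ (tensorOp σ)) : Φ = Ψ := by
  refine LinearMap.ext fun ρ => ?_
  rw [Matrix.matrix_eq_sum_single ρ]
  simp only [map_sum]
  refine Finset.sum_congr rfl fun a _ => Finset.sum_congr rfl fun b _ => ?_
  have : Matrix.single a b (ρ a b) = ρ a b • Matrix.single a b (1 : ℂ) := by simp
  rw [this, map_smul, map_smul, single_eq_tensorOp, h]

/-- The superoperator acting as `Φ` on party `K` and trivially on the others. -/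
def localMap (K : Fin 3) (Φ : SuperOp (Fin 2)) : SuperOp Bits :=
  tensorMap (Function.update (fun _ => LinearMap.id) K Φ)

theorem localMap_tensorOp (K : Fin 3) (Φ : SuperOp (Fin 2))
    (σ : Fin 3 → Matrix (Fin 2) (Fin 2) ℂ) :
    localMap K Φ (tensorOp σ) = tensorOp (Function.update σ K (Φ (σ K))) := by
  rw [localMap, tensorMap_tensorOp]
  congr 1
  ext1 J
  by_cases h : J = K
  · subst h; simp
  · simp [h]

theorem localMap_sum_conjMap (K : Fin 3) {n : ℕ} (A : Fin n → Matrix (Fin 2) (Fin 2) ℂ) :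
    localMap K (∑ i, conjMap (A i)) = ∑ i, conjMap (localOp K (A i)) := by
  refine superOp_ext fun σ => ?_
  rw [localMap_tensorOp, LinearMap.sum_apply, LinearMap.sum_apply, ← tensorOpLin_apply, map_sum]
  refine Finset.sum_congr rfl fun i _ => ?_
  rw [tensorOpLin_apply, conjMap_apply, conjMap_apply, localOp_conjTranspose,
    localOp_mul_tensorOp, tensorOp_mul_localOp, Function.update_self, Function.update_idem]

/-- Party `K` is made to act first, so that the trace-preserving maps of the other parties can be
absorbed into the functional applied afterwards. -/
theorem tensorMap_eq_comp (K : Fin 3) (Φ : Fin 3 → SuperOp (Fin 2)) :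
    tensorMap Φ
      = localMap (K + 1) (Φ (K + 1)) ∘ₗ localMap (K + 2) (Φ (K + 2)) ∘ₗ localMap K (Φ K) := by
  obtain ⟨ne1, ne2, ne3⟩ := fin_three_add_ne K
  refine superOp_ext fun σ => ?_
  rw [LinearMap.comp_apply, LinearMap.comp_apply, localMap_tensorOp, localMap_tensorOp,
    localMap_tensorOp, tensorMap_tensorOp]
  congr 1
  ext1 J
  rcases fin_three_cases K J with rfl | rfl | rfl
  · simp [ne1.symm, ne2.symm]
  · simp [ne1, ne3.symm]
  · simp [ne2, ne3]

/-! ## Monotonicity under finite-round protocols, by duality -/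

/-- Real-linear functionals that are bounded by `𝒞` on the cone over the W class. -/
def IsFeasible (star : Fin 3) (ℓ : Matrix Bits Bits ℂ →ₗ[ℝ] ℝ) : Prop :=
  ∀ ξ, IsWCone ξ → ℓ (ketbra ξ) ≤ conc star ξ

theorem isFeasible_zero (star : Fin 3) : IsFeasible star 0 := fun ξ _ => conc_nonneg star ξ

/-- Pulling back feasible functionals along the family yields a feasible functional. -/
def IsMonotoneFamily (star : Fin 3) {Θ : Type} (E : OpFamily Bits Θ) : Prop :=
  ∀ (s : Finset Θ) (ℓ : Θ → Matrix Bits Bits ℂ →ₗ[ℝ] ℝ), (∀ j, IsFeasible star (ℓ j)) →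
    IsFeasible star (∑ j ∈ s, ℓ j ∘ₗ (E j).restrictScalars ℝ)

theorem isMonotoneFamily_iff {star : Fin 3} {Θ : Type} {E : OpFamily Bits Θ} :
    IsMonotoneFamily star E ↔ ∀ (s : Finset Θ) (ℓ : Θ → Matrix Bits Bits ℂ →ₗ[ℝ] ℝ),
      (∀ j, IsFeasible star (ℓ j)) → ∀ ξ, IsWCone ξ →
        ∑ j ∈ s, ℓ j (E j (ketbra ξ)) ≤ conc star ξ := by
  simp [IsMonotoneFamily, IsFeasible, LinearMap.sum_apply]

theorem sum_conc_localOp_le {star K : Fin 3} {ξ : Bits → ℂ} (hξ : IsWCone ξ) {ι : Type}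
    (s : Finset ι) (M : ι → Matrix (Fin 2) (Fin 2) ℂ)
    (hM : ∀ v, ∑ i ∈ s, sqNorm ((M i).mulVec v) ≤ sqNorm v) :
    ∑ i ∈ s, conc star ((localOp K (M i)).mulVec ξ) ≤ conc star ξ := by
  obtain ⟨v₀, v₁, A, B, h0, h1, hA, hB, hAB, h⟩ := hξ.exists_local_bound star K
  calc ∑ i ∈ s, conc star ((localOp K (M i)).mulVec ξ)
      ≤ ∑ i ∈ s, (A * sqNorm ((M i).mulVec v₀) + B * sqNorm ((M i).mulVec v₁)) :=
        Finset.sum_le_sum fun i _ => (h (M i)).2.1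
    _ = A * ∑ i ∈ s, sqNorm ((M i).mulVec v₀) + B * ∑ i ∈ s, sqNorm ((M i).mulVec v₁) := by
        rw [Finset.sum_add_distrib, Finset.mul_sum, Finset.mul_sum]
    _ ≤ A * 1 + B * 1 := by
        gcongr
        · exact h0 ▸ hM v₀
        · exact h1 ▸ hM v₁
    _ = conc star ξ := by rw [mul_one, mul_one, hAB]

/-- Kraus decompositions turn the outputs into sums of pure vectors in the cone, where each
functional is at most `conc`. All the Kraus operators together form one sub-normalized measurement
by party `K`. -/
theorem sum_feasible_localMap_le {star K : Fin 3} {Θ : Type} (s : Finset Θ)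
    {Φ : Θ → SuperOp (Fin 2)} (hCP : ∀ j, IsCP (Φ j))
    (hΦ : ∀ v, ∑ j ∈ s, (Φ j (Matrix.vecMulVec v (Star.star v))).trace.re ≤ sqNorm v)
    {ℓ : Θ → Matrix Bits Bits ℂ →ₗ[ℝ] ℝ} (hℓ : ∀ j, IsFeasible star (ℓ j)) {ξ : Bits → ℂ}
    (hξ : IsWCone ξ) : ∑ j ∈ s, ℓ j (localMap K (Φ j) (ketbra ξ)) ≤ conc star ξ := by
  choose n A hA using hCP
  have e1 : ∀ j, ℓ j (localMap K (Φ j) (ketbra ξ))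
      = ∑ i, ℓ j (ketbra ((localOp K (A j i)).mulVec ξ)) := by
    intro j
    rw [hA j, localMap_sum_conjMap, LinearMap.sum_apply, map_sum]
    simp only [conjMap_ketbra]
  have e2 : ∀ j v, (Φ j (Matrix.vecMulVec v (Star.star v))).trace.re
      = ∑ i, sqNorm ((A j i).mulVec v) := by
    intro j v
    rw [hA j, LinearMap.sum_apply, Matrix.trace_sum, Complex.re_sum]
    refine Finset.sum_congr rfl fun i _ => ?_
    rw [conjMap_vecMulVec, trace_vecMulVec_star, Complex.ofReal_re]
  simp only [e1]
  calc ∑ j ∈ s, ∑ i, ℓ j (ketbra ((localOp K (A j i)).mulVec ξ))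
      ≤ ∑ j ∈ s, ∑ i, conc star ((localOp K (A j i)).mulVec ξ) :=
        Finset.sum_le_sum fun j _ => Finset.sum_le_sum fun i _ => hℓ j _ (hξ.localOp K _)
    _ = ∑ q ∈ s.sigma fun j => (Finset.univ : Finset (Fin (n j))),
          conc star ((localOp K (A q.1 q.2)).mulVec ξ) := by rw [Finset.sum_sigma]
    _ ≤ conc star ξ := by
        refine sum_conc_localOp_le hξ _ (fun q : (j : Θ) × Fin (n j) => A q.1 q.2) fun v => ?_
        rw [Finset.sum_sigma]
        simpa only [e2] using hΦ v

theorem IsFeasible.comp_localMap {star : Fin 3} {ℓ : Matrix Bits Bits ℂ →ₗ[ℝ] ℝ}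
    (hℓ : IsFeasible star ℓ) (K : Fin 3) {Φ : SuperOp (Fin 2)} (hCP : IsCP Φ) (hTP : IsTP Φ) :
    IsFeasible star (ℓ ∘ₗ (localMap K Φ).restrictScalars ℝ) := by
  intro ξ hξ
  have := sum_feasible_localMap_le (K := K) (star := star) ({()} : Finset Unit) (Φ := fun _ => Φ)
    (fun _ => hCP) (fun v => by
      rw [Finset.sum_singleton, hTP, trace_vecMulVec_star, Complex.ofReal_re]) (ℓ := fun _ => ℓ)
    (fun _ => hℓ) hξ
  simpa using this

theorem IsCP.trace_re_nonneg {Φ : SuperOp (Fin 2)} (h : IsCP Φ) (v : Fin 2 → ℂ) :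
    0 ≤ (Φ (Matrix.vecMulVec v (star v))).trace.re := by
  obtain ⟨n, A, rfl⟩ := h
  rw [LinearMap.sum_apply, Matrix.trace_sum, Complex.re_sum]
  refine Finset.sum_nonneg fun i _ => ?_
  rw [conjMap_vecMulVec, trace_vecMulVec_star, Complex.ofReal_re]
  exact sqNorm_nonneg _

theorem IsOneWayLocal.isMonotoneFamily {Θ : Type} {K : Fin 3} {E : OpFamily Bits Θ}
    (hE : IsOneWayLocal K E) (star : Fin 3) : IsMonotoneFamily star E := by
  obtain ⟨hI, Φ, hΦ⟩ := hE
  obtain ⟨ne1, ne2, -⟩ := fin_three_add_ne K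
  -- The normalization of the instrument concerns all three parties; testing it on a product with
  -- normalized states of the other two isolates that of the maps of party `K`.
  have hsum : ∀ v : Fin 2 → ℂ,
      HasSum (fun j => (Φ j K (Matrix.vecMulVec v (Star.star v))).trace.re) (sqNorm v) := by
    intro v
    let σ : Fin 3 → Matrix (Fin 2) (Fin 2) ℂ :=
      Function.update (fun _ => Matrix.single 0 0 1) K (Matrix.vecMulVec v (Star.star v))
    have h := Complex.reCLM.hasSum (hI.2 (tensorOp σ))
    have hσ : ∀ f : Fin 3 → ℂ, (∀ J, J ≠ K → f J = 1) → ∏ J, f J = f K := fun f hf =>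
      Finset.prod_eq_single K (fun J _ hJ => hf J hJ) (fun h => absurd (Finset.mem_univ K) h)
    have e1 : Complex.reCLM (tensorOp σ).trace = sqNorm v := by
      rw [trace_tensorOp, hσ _ fun J hJ => by simp [σ, hJ]]
      simp only [σ, Function.update_self, trace_vecMulVec_star]
      exact Complex.ofReal_re _
    have e2 : ∀ j, Complex.reCLM (E j (tensorOp σ)).trace
        = (Φ j K (Matrix.vecMulVec v (Star.star v))).trace.re := by
      intro j
      rw [(hΦ j).1, tensorMap_tensorOp, trace_tensorOp, hσ _ fun J hJ => by
        rw [(hΦ j).2.2 J hJ]; simp [σ, hJ]]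
      simp [σ]
    rw [e1] at h
    exact (funext e2) ▸ h
  rw [isMonotoneFamily_iff]
  intro s ℓ hℓ ξ hξ
  have hℓ' := fun j => ((hℓ j).comp_localMap (K + 1) ((hΦ j).2.1 (K + 1))
    ((hΦ j).2.2 _ ne1)).comp_localMap (K + 2) ((hΦ j).2.1 (K + 2)) ((hΦ j).2.2 _ ne2)
  have := sum_feasible_localMap_le (K := K) s (fun j => (hΦ j).2.1 K) (fun v =>
    sum_le_hasSum s (fun j _ => ((hΦ j).2.1 K).trace_re_nonneg v) (hsum v)) hℓ' hξ
  refine le_trans (le_of_eq (Finset.sum_congr rfl fun j _ => ?_)) this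
  rw [(hΦ j).1, tensorMap_eq_comp K]
  rfl

open Classical in
theorem IsMonotoneFamily.coarseGraining {star : Fin 3} {Θ Θ' : Type} {E : OpFamily Bits Θ}
    {F : OpFamily Bits Θ'} (hE : IsMonotoneFamily star E) (hF : IsCoarseGraining F E) :
    IsMonotoneFamily star F := by
  rw [isMonotoneFamily_iff] at hE ⊢
  obtain ⟨f, hf⟩ := hF
  intro s ℓ hℓ ξ hξ
  have h1 : ∀ k ∈ s, HasSum (fun j => if f j = k then ℓ (f j) (E j (ketbra ξ)) else 0)
      (ℓ k (F k (ketbra ξ))) := by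
    intro k _
    have h := (hf k (ketbra ξ)).map (ℓ k) (ℓ k).continuous_of_finiteDimensional
    have h' : HasSum ((fun j => ℓ k (E j (ketbra ξ))) ∘ ((↑) : {j | f j = k} → Θ))
        (ℓ k (F k (ketbra ξ))) := h
    rw [hasSum_subtype_iff_indicator] at h'
    convert h' using 2 with j
    by_cases hj : f j = k
    · simp [hj]
    · simp [hj]
  refine hasSum_le_of_sum_le (hasSum_sum h1) fun t => ?_
  -- Each fine outcome receives the functional of its coarse outcome, and the feasible functional 0
  -- if that lies outside `s`. The coarse sum is then the limit of finite sums bounded by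
  -- monotonicity of `E`.
  have := hE t (fun j => if f j ∈ s then ℓ (f j) else 0) (fun j => by
    split_ifs
    · exact hℓ _
    · exact isFeasible_zero star) ξ hξ
  refine le_trans (le_of_eq (Finset.sum_congr rfl fun j _ => ?_)) this
  rw [Finset.sum_ite_eq]
  split_ifs <;> simp

open Classical in
theorem IsMonotoneFamily.sigma_comp {star : Fin 3} {Θ : Type} {κ : Θ → Type}
    {E : OpFamily Bits Θ} {B : (j : Θ) → OpFamily Bits (κ j)} (hE : IsMonotoneFamily star E)
    (hB : ∀ j, IsMonotoneFamily star (B j)) :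
    IsMonotoneFamily star (fun i : (j : Θ) × κ j => B i.1 i.2 ∘ₗ E i.1) := by
  rw [isMonotoneFamily_iff] at hE ⊢
  intro s ℓ hℓ ξ hξ
  let t : (j : Θ) → Finset (κ j) := fun j => s.preimage (Sigma.mk j) sigma_mk_injective.injOn
  have hs : s = (s.image Sigma.fst).sigma t := by
    ext ⟨j, m⟩
    simp only [Finset.mem_sigma, Finset.mem_image, t, Finset.mem_preimage]
    exact ⟨fun h => ⟨⟨_, h, rfl⟩, h⟩, fun h => h.2⟩
  -- The functional for outcome j of the first round is the sum of those for its continuations,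
  -- pulled back along `B j`; it is feasible because `B j` is monotone.
  have := hE (s.image Sigma.fst)
    (fun j => ∑ m ∈ t j, ℓ ⟨j, m⟩ ∘ₗ (B j m).restrictScalars ℝ)
    (fun j => hB j (t j) (fun m => ℓ ⟨j, m⟩) fun m => hℓ _) ξ hξ
  rw [hs, Finset.sum_sigma]
  simpa [LinearMap.sum_apply] using this

theorem IsMonotoneFamily.of_tendsto {star : Fin 3} {Θ : Type} {E : OpFamily Bits Θ}
    {G : ℕ → OpFamily Bits Θ} (hG : ∀ ν, IsMonotoneFamily star (G ν))
    (h : ∀ j ρ, Tendsto (fun ν => G ν j ρ) atTop (𝓝 (E j ρ))) : IsMonotoneFamily star E := by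
  simp only [isMonotoneFamily_iff] at hG ⊢
  intro s ℓ hℓ ξ hξ
  have hlim : Tendsto (fun ν => ∑ j ∈ s, ℓ j (G ν j (ketbra ξ))) atTop
      (𝓝 (∑ j ∈ s, ℓ j (E j (ketbra ξ)))) := tendsto_finsetSum s fun j _ =>
    ((ℓ j).continuous_of_finiteDimensional.tendsto _).comp (h j (ketbra ξ))
  exact le_of_tendsto' hlim fun ν => hG ν s ℓ hℓ ξ hξ

theorem IsLOCCRounds.isMonotoneFamily (star : Fin 3) {r : ℕ} {Θ : Type} {E : OpFamily Bits Θ}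
    (h : IsLOCCRounds r E) : IsMonotoneFamily star E := by
  induction h with
  | one K E F hE hF => exact (hE.isMonotoneFamily star).coarseGraining hF
  | succ r E E' hE hE' ih =>
    obtain ⟨κ, _, K, B, hB, hc⟩ := hE'
    exact (ih.sigma_comp fun j => (hB j).isMonotoneFamily star).coarseGraining hc

/-! ## Convergence in the diamond norm -/

section TraceNorm

variable {R : Type} [Fintype R] [DecidableEq R]

theorem sum_eigenvalues_conjTranspose_mul_self (X : Matrix R R ℂ) :
    ∑ i, (Matrix.isHermitian_conjTranspose_mul_self X).eigenvalues i
      = ∑ a, ∑ b, ‖X a b‖ ^ 2 := by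
  have h := (Matrix.isHermitian_conjTranspose_mul_self X).trace_eq_sum_eigenvalues
  have h2 : (X.conjTranspose * X).trace = ((∑ a, ∑ b, ‖X a b‖ ^ 2 : ℝ) : ℂ) := by
    rw [Matrix.trace, Finset.sum_comm]
    push_cast
    refine Finset.sum_congr rfl fun b _ => ?_
    rw [Matrix.diag_apply, Matrix.mul_apply]
    refine Finset.sum_congr rfl fun a _ => ?_
    rw [Matrix.conjTranspose_apply]
    exact Complex.conj_mul' _
  rw [h2, ← RCLike.ofReal_sum] at h
  exact (Complex.ofReal_injective h).symm

open scoped ComplexOrder in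
theorem eigenvalues_conjTranspose_mul_self_nonneg (X : Matrix R R ℂ) (i : R) :
    0 ≤ (Matrix.isHermitian_conjTranspose_mul_self X).eigenvalues i :=
  (Matrix.posSemidef_conjTranspose_mul_self X).eigenvalues_nonneg i

/-- The Hilbert-Schmidt norm lies in between: it dominates every entry, and it is the ℓ² norm of the
singular values, of which the trace norm is the ℓ¹ norm. -/
theorem norm_apply_le_traceNorm (X : Matrix R R ℂ) (a b : R) : ‖X a b‖ ≤ traceNorm X := by
  have h0 : 0 ≤ traceNorm X := Finset.sum_nonneg fun _ _ => Real.sqrt_nonneg _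
  refine (sq_le_sq₀ (norm_nonneg _) h0).mp ?_
  calc ‖X a b‖ ^ 2 ≤ ∑ b, ‖X a b‖ ^ 2 :=
        Finset.single_le_sum (f := fun b => ‖X a b‖ ^ 2) (fun _ _ => sq_nonneg _)
          (Finset.mem_univ b)
    _ ≤ ∑ a, ∑ b, ‖X a b‖ ^ 2 :=
        Finset.single_le_sum (f := fun a => ∑ b, ‖X a b‖ ^ 2)
          (fun _ _ => Finset.sum_nonneg fun _ _ => sq_nonneg _) (Finset.mem_univ a)
    _ = ∑ i, √((Matrix.isHermitian_conjTranspose_mul_self X).eigenvalues i) ^ 2 := by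
        rw [← sum_eigenvalues_conjTranspose_mul_self]
        exact Finset.sum_congr rfl fun i _ =>
          (Real.sq_sqrt (eigenvalues_conjTranspose_mul_self_nonneg X i)).symm
    _ ≤ traceNorm X ^ 2 := Finset.sum_sq_le_sq_sum_of_nonneg fun _ _ => Real.sqrt_nonneg _

theorem traceNorm_sq_le (X : Matrix R R ℂ) :
    traceNorm X ^ 2 ≤ Fintype.card R * ∑ a, ∑ b, ‖X a b‖ ^ 2 := by
  rw [← sum_eigenvalues_conjTranspose_mul_self]
  refine (sq_sum_le_card_mul_sum_sq (s := Finset.univ)).trans (le_of_eq ?_)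
  rw [Finset.card_univ]
  congr 1
  exact Finset.sum_congr rfl fun i _ =>
    Real.sq_sqrt (eigenvalues_conjTranspose_mul_self_nonneg X i)

end TraceNorm

/-- A one-dimensional auxiliary system and a rescaled copy of `ρ` as test operator suffice, so
diamond-norm convergence implies entrywise convergence. -/
theorem exists_mul_norm_le_diamondNorm (ρ : Matrix Bits Bits ℂ) : ∃ c : ℝ, 0 < c ∧
    ∀ (Φ : SuperOp Bits) (s t : Bits), ENNReal.ofReal (c * ‖Φ ρ s t‖) ≤ diamondNorm Φ := by
  set N : ℝ := Fintype.card (Bits × Fin 1) *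
    ∑ a : Bits × Fin 1, ∑ b : Bits × Fin 1, ‖ρ a.1 b.1‖ ^ 2 with hN
  have hN0 : 0 ≤ N := by positivity
  -- `N` bounds the squared trace norm of `ρ`, and N / (1 + N)² ≤ 1; the summand 1 covers `ρ = 0`.
  have hc : 0 < 1 / (1 + N) := by positivity
  refine ⟨1 / (1 + N), hc, fun Φ s t => ?_⟩
  let X : Matrix (Bits × Fin 1) (Bits × Fin 1) ℂ :=
    Matrix.of fun a b => ((1 / (1 + N) : ℝ) : ℂ) * ρ a.1 b.1
  have hX : traceNorm X ≤ 1 := by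
    have h0 : 0 ≤ traceNorm X := Finset.sum_nonneg fun _ _ => Real.sqrt_nonneg _
    rw [← sq_le_one_iff₀ h0]
    refine (traceNorm_sq_le X).trans ?_
    have : (Fintype.card (Bits × Fin 1) : ℝ) * ∑ a, ∑ b, ‖X a b‖ ^ 2 = (1 / (1 + N)) ^ 2 * N := by
      simp only [X, Matrix.of_apply, norm_mul, mul_pow, ← Finset.mul_sum, Complex.norm_real,
        Real.norm_eq_abs, sq_abs]
      rw [hN]; ring
    rw [this, one_div, inv_pow, ← div_eq_inv_mul, div_le_one (by positivity)]
    nlinarith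
  have hΦ : ampliate 1 Φ X (s, 0) (t, 0) = ((1 / (1 + N) : ℝ) : ℂ) * Φ ρ s t := by
    have : (Matrix.of fun u v => X (u, 0) (v, 0)) = ((1 / (1 + N) : ℝ) : ℂ) • ρ := by
      ext u v; simp [X]
    simp only [ampliate, Matrix.of_apply, this, map_smul, Matrix.smul_apply, smul_eq_mul]
  refine le_trans (ENNReal.ofReal_le_ofReal ?_)
    (le_iSup_of_le 1 (le_iSup_of_le X (le_iSup_of_le hX le_rfl)))
  have := norm_apply_le_traceNorm (ampliate 1 Φ X) (s, 0) (t, 0)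
  rwa [hΦ, norm_mul, Complex.norm_real, Real.norm_eq_abs, abs_of_pos hc] at this

theorem tendsto_apply_of_instrumentDist {Θ : Type} {E : OpFamily Bits Θ}
    {G : ℕ → OpFamily Bits Θ} (h : Tendsto (fun ν => instrumentDist (G ν) E) atTop (𝓝 0)) (j : Θ)
    (ρ : Matrix Bits Bits ℂ) : Tendsto (fun ν => G ν j ρ) atTop (𝓝 (E j ρ)) := by
  obtain ⟨c, hc, hbound⟩ := exists_mul_norm_le_diamondNorm ρ
  refine tendsto_pi_nhds.mpr fun s => tendsto_pi_nhds.mpr fun t => ?_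
  have h1 : Tendsto (fun ν => ENNReal.ofReal (c * ‖(G ν j - E j) ρ s t‖)) atTop (𝓝 0) :=
    tendsto_of_tendsto_of_tendsto_of_le_of_le tendsto_const_nhds h (fun _ => zero_le)
      fun ν => (hbound _ s t).trans (ENNReal.le_tsum (f := fun j => diamondNorm (G ν j - E j)) j)
  have h2 := (ENNReal.tendsto_toReal ENNReal.zero_ne_top).comp h1
  have h3 : Tendsto (fun ν => c * ‖(G ν j - E j) ρ s t‖) atTop (𝓝 0) := by
    refine h2.congr fun ν => ?_
    exact ENNReal.toReal_ofReal (by positivity)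
  rw [tendsto_iff_norm_sub_tendsto_zero]
  have h4 := h3.const_mul c⁻¹
  rw [mul_zero] at h4
  refine h4.congr fun ν => ?_
  rw [← mul_assoc, inv_mul_cancel₀ hc.ne', one_mul]
  rfl

theorem IsLOCC.isMonotoneFamily (star : Fin 3) {Θ : Type} {E : OpFamily Bits Θ} (h : IsLOCC E) :
    IsMonotoneFamily star E := by
  obtain ⟨-, ι, F, G, hF, -, hG, hlim⟩ := h
  refine IsMonotoneFamily.of_tendsto (G := G) (fun ν => ?_)
    fun j ρ => tendsto_apply_of_instrumentDist hlim j ρ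
  obtain ⟨r, hr⟩ := hF ν
  exact (hr.isMonotoneFamily star).coarseGraining (hG ν)

/-! ## Compactness of the W class and continuity of `𝒞` -/

theorem isWClass_iff {ξ : Bits → ℂ} : IsWClass ξ ↔ IsWCone ξ ∧ sqNorm ξ = 1 :=
  ⟨fun ⟨_, hx⟩ => ⟨hx.isWCone, hx.sqNorm_eq_one⟩, fun h => h.1.isWClass h.2⟩

theorem isCompact_unitaryGroup :
    IsCompact {U : Matrix (Fin 2) (Fin 2) ℂ | U ∈ Matrix.unitaryGroup (Fin 2) ℂ} := by
  have hc : IsCompact (Set.univ.pi fun _ : Fin 2 => Set.univ.pi fun _ : Fin 2 =>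
      Metric.closedBall (0 : ℂ) 1) :=
    isCompact_univ_pi fun _ => isCompact_univ_pi fun _ => isCompact_closedBall 0 1
  refine hc.of_isClosed_subset ?_ fun U hU i _ j _ => ?_
  · have h1 : Continuous fun U : Matrix (Fin 2) (Fin 2) ℂ => U * U.conjTranspose :=
      continuous_id.matrix_mul continuous_id.matrix_conjTranspose
    have : {U : Matrix (Fin 2) (Fin 2) ℂ | U ∈ Matrix.unitaryGroup (Fin 2) ℂ}
        = {U | U * U.conjTranspose = 1} := by
      ext U; exact Matrix.mem_unitaryGroup_iff
    rw [this]
    exact isClosed_eq h1 continuous_const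
  · rw [mem_closedBall_zero_iff]
    exact entry_norm_bound_of_unitary hU i j

/-- The W class is the continuous image of the product of the parameter simplex and three copies of
the unitary group. -/
theorem isCompact_isWClass : IsCompact {ξ : Bits → ℂ | IsWClass ξ} := by
  have hx : IsCompact {x : Fin 3 → ℝ | (∀ K, 0 ≤ x K) ∧ ∑ K, x K ≤ 1} := by
    have hc : IsCompact (Set.univ.pi fun _ : Fin 3 => Set.Icc (0 : ℝ) 1) :=
      isCompact_univ_pi fun _ => isCompact_Icc
    refine hc.of_isClosed_subset ?_ fun x hx K _ => ⟨hx.1 K, ?_⟩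
    · refine IsClosed.inter ?_ (isClosed_le
        (continuous_finsetSum _ fun K _ => continuous_apply K) continuous_const)
      have : {x : Fin 3 → ℝ | ∀ K, 0 ≤ x K} = ⋂ K, {x | 0 ≤ x K} := by ext; simp
      change IsClosed {x : Fin 3 → ℝ | ∀ K, 0 ≤ x K}
      rw [this]
      exact isClosed_iInter fun K => isClosed_le continuous_const (continuous_apply K)
    · exact (Finset.single_le_sum (fun K _ => hx.1 K) (Finset.mem_univ K)).trans hx.2
  have hU : IsCompact (Set.univ.pi fun _ : Fin 3 =>
      {U : Matrix (Fin 2) (Fin 2) ℂ | U ∈ Matrix.unitaryGroup (Fin 2) ℂ}) :=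
    isCompact_univ_pi fun _ => isCompact_unitaryGroup
  have hcont : Continuous fun q : (Fin 3 → ℝ) × (Fin 3 → Matrix (Fin 2) (Fin 2) ℂ) =>
      (tensorOp q.2).mulVec (wKet q.1) := by
    have h1 : Continuous fun q : (Fin 3 → ℝ) × (Fin 3 → Matrix (Fin 2) (Fin 2) ℂ) =>
        tensorOp q.2 := by
      refine continuous_matrix fun s t => ?_
      simp only [tensorOp, Matrix.of_apply]
      exact continuous_finsetProd _ fun J _ =>
        ((continuous_apply J).comp continuous_snd).matrix_elem _ _
    have h2 : Continuous fun q : (Fin 3 → ℝ) × (Fin 3 → Matrix (Fin 2) (Fin 2) ℂ) =>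
        wKet q.1 := by
      refine continuous_pi fun s => ?_
      unfold wKet
      refine Continuous.add ?_ (continuous_finsetSum _ fun K _ => ?_)
      · split_ifs
        · fun_prop
        · exact continuous_const
      · split_ifs
        · fun_prop
        · exact continuous_const
    exact h1.matrix_mulVec h2
  convert (hx.prod hU).image hcont using 1
  ext ξ
  constructor
  · rintro ⟨x, h0, h1, U, hU, rfl⟩
    exact ⟨(x, U), ⟨⟨h0, h1⟩, fun J _ => hU J⟩, rfl⟩
  · rintro ⟨⟨x, U⟩, ⟨⟨h0, h1⟩, hU⟩, rfl⟩
    exact ⟨x, h0, h1, U, fun J => hU J (Set.mem_univ J), rfl⟩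

theorem continuous_concPair_comp {X : Type*} [TopologicalSpace X] {f g : X → ℝ}
    (hf : Continuous f) (hg : Continuous g) (hf0 : ∀ a, 0 ≤ f a) (hg0 : ∀ a, 0 ≤ g a) :
    Continuous fun a => concPair (f a) (g a) := by
  have hmax : Continuous fun a => max (f a) (g a) := hf.max hg
  have hmin : Continuous fun a => min (f a) (g a) := hf.min hg
  refine hmax.add (continuous_iff_continuousAt.mpr fun a => ?_)
  rcases eq_or_ne (max (f a) (g a)) 0 with h | h
  -- Where both functions vanish the quotient is 0 / 0 = 0, and nearby it is squeezed between 0 and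
  -- the maximum.
  · have hb : ∀ b, min (f b) (g b) ^ 2 / (3 * max (f b) (g b)) ≤ max (f b) (g b) := by
      intro b
      have h0 : 0 ≤ min (f b) (g b) := le_min (hf0 b) (hg0 b)
      have h1 : min (f b) (g b) ≤ max (f b) (g b) := min_le_max
      refine div_le_of_le_mul₀ (by linarith) (h0.trans h1) ?_
      nlinarith
    have ht : Tendsto (fun b => max (f b) (g b)) (𝓝 a) (𝓝 0) := h ▸ hmax.tendsto a
    rw [ContinuousAt, h, mul_zero, div_zero]
    refine squeeze_zero (fun b => ?_) hb ht
    have : 0 ≤ max (f b) (g b) := (hf0 b).trans (le_max_left _ _)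
    positivity
  · exact (hmin.continuousAt.pow 2).div (continuousAt_const.mul hmax.continuousAt)
      (mul_ne_zero three_ne_zero h)

theorem continuous_conc (star : Fin 3) : Continuous (conc star) := by
  have h := continuous_redDet_ketbra
  refine continuous_concPair_comp ?_ ?_ (concFst_nonneg star) (concSnd_nonneg star)
  · exact (continuous_const.mul (((h _).add (h _)).sub (h _))).sqrt
  · exact (continuous_const.mul (((h _).add (h _)).sub (h _))).sqrt

/-! ## Supporting functionals -/

/-- The component of `ξ` orthogonal to a unit vector. -/
theorem sqNorm_sub_proj {φ : Bits → ℂ} (hφ : sqNorm φ = 1) (ξ : Bits → ℂ) :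
    sqNorm (ξ - (star φ ⬝ᵥ ξ) • φ) = sqNorm ξ - ‖star φ ⬝ᵥ ξ‖ ^ 2 := by
  have h1 : star φ ⬝ᵥ φ = 1 := by rw [star_dotProduct_self, hφ, Complex.ofReal_one]
  have h2 : star ξ ⬝ᵥ φ = star (star φ ⬝ᵥ ξ) := by
    rw [Matrix.star_dotProduct]
  have h3 := Complex.conj_mul' (star φ ⬝ᵥ ξ)
  apply Complex.ofReal_injective
  rw [← star_dotProduct_self, star_sub, star_smul, sub_dotProduct, dotProduct_sub, dotProduct_sub,
    smul_dotProduct, smul_dotProduct, dotProduct_smul, dotProduct_smul, h1, h2,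
    star_dotProduct_self]
  push_cast
  rw [← h3]
  simp only [smul_eq_mul, RCLike.star_def]
  ring

/-- On unit vectors with overlap o = |⟨φ|ξ⟩|² the left side is c o - k (1 - o). It can violate the
bound only where `conc` is at most c o; this set is compact and stays away from o = 1 because c <
`conc φ` if φ is in the cone. A large penalty `k` therefore works, and homogeneity extends the bound
to the cone. -/
theorem exists_support (star : Fin 3) {φ : Bits → ℂ} (hφ : sqNorm φ = 1) {c : ℝ}
    (hc : IsWCone φ → c < conc star φ) : ∃ k : ℝ, ∀ ξ, IsWCone ξ →
      (c + k) * ‖Star.star φ ⬝ᵥ ξ‖ ^ 2 - k * sqNorm ξ ≤ conc star ξ := by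
  have hov : Continuous fun ξ : Bits → ℂ => ‖Star.star φ ⬝ᵥ ξ‖ ^ 2 :=
    ((continuous_const.dotProduct continuous_id).norm).pow 2
  let S : Set (Bits → ℂ) := {ξ | IsWClass ξ} ∩ {ξ | conc star ξ ≤ c * ‖Star.star φ ⬝ᵥ ξ‖ ^ 2}
  have hS : IsCompact S :=
    isCompact_isWClass.inter_right (isClosed_le (continuous_conc star) (continuous_const.mul hov))
  have hle1 : ∀ ξ, sqNorm ξ = 1 → ‖Star.star φ ⬝ᵥ ξ‖ ^ 2 ≤ 1 := by
    intro ξ hξ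
    have := sqNorm_sub_proj hφ ξ
    have := sqNorm_nonneg (ξ - (Star.star φ ⬝ᵥ ξ) • φ)
    linarith
  -- Overlap 1 would make `ξ` a phase times `φ`, so that `φ` would be in the cone with `conc φ ≤ c`.
  have hlt : ∀ ξ ∈ S, 0 < 1 - ‖Star.star φ ⬝ᵥ ξ‖ ^ 2 := by
    intro ξ hξ
    obtain ⟨hW, hle⟩ := hξ
    have hle : conc star ξ ≤ c * ‖Star.star φ ⬝ᵥ ξ‖ ^ 2 := hle
    obtain ⟨hW, h1⟩ := isWClass_iff.mp hW
    refine lt_of_le_of_ne (sub_nonneg.mpr (hle1 ξ h1)) fun heq => ?_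
    have hn : ‖Star.star φ ⬝ᵥ ξ‖ ^ 2 = 1 := by linarith
    have h0 := sqNorm_sub_proj hφ ξ
    rw [h1, hn, sub_self] at h0
    have hξ := sub_eq_zero.mp (sqNorm_eq_zero h0)
    have ha : Star.star φ ⬝ᵥ ξ ≠ 0 := by
      intro h; rw [h] at hn; simp at hn
    have hφξ : φ = (Star.star φ ⬝ᵥ ξ)⁻¹ • ξ := by
      conv_rhs => rw [hξ]
      have e : Star.star φ ⬝ᵥ ((Star.star φ ⬝ᵥ ξ) • φ) = Star.star φ ⬝ᵥ ξ := by rw [← hξ]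
      rw [e, smul_smul, inv_mul_cancel₀ ha, one_smul]
    have hφW : IsWCone φ := by rw [hφξ]; exact hW.smul _
    have e : conc star ξ = conc star φ := by
      have e' := conc_smul star (Star.star φ ⬝ᵥ ξ) φ
      rwa [← hξ, hn, one_mul] at e'
    have := hc hφW
    rw [e, hn, mul_one] at hle
    linarith
  have hk : ∃ k : ℝ, ∀ ξ ∈ S, |c| ≤ k * (1 - ‖Star.star φ ⬝ᵥ ξ‖ ^ 2) := by
    rcases S.eq_empty_or_nonempty with h | h
    · exact ⟨0, fun ξ hξ => by rw [h] at hξ; exact hξ.elim⟩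
    obtain ⟨ξ₀, hξ₀, hmin⟩ := hS.exists_isMinOn h (continuous_const.sub hov).continuousOn
    have h0 := hlt ξ₀ hξ₀
    refine ⟨|c| / (1 - ‖Star.star φ ⬝ᵥ ξ₀‖ ^ 2), fun ξ hξ => ?_⟩
    rw [div_mul_eq_mul_div, le_div_iff₀ h0]
    exact mul_le_mul_of_nonneg_left (hmin hξ) (abs_nonneg c)
  obtain ⟨k₀, hk₀⟩ := hk
  let k := max k₀ 0
  have hk : ∀ ξ ∈ S, |c| ≤ k * (1 - ‖Star.star φ ⬝ᵥ ξ‖ ^ 2) := fun ξ hξ =>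
    (hk₀ ξ hξ).trans (mul_le_mul_of_nonneg_right (le_max_left _ _) (hlt ξ hξ).le)
  have hk0 : 0 ≤ k := le_max_right _ _
  have hunit : ∀ ξ, IsWCone ξ → sqNorm ξ = 1 →
      (c + k) * ‖Star.star φ ⬝ᵥ ξ‖ ^ 2 - k * sqNorm ξ ≤ conc star ξ := by
    intro ξ hW h1
    have ho := hle1 ξ h1
    have ho0 := sq_nonneg ‖Star.star φ ⬝ᵥ ξ‖
    rw [h1]
    by_cases hξ : ξ ∈ S
    · have := hk ξ hξ
      have := conc_nonneg star ξ
      have := mul_le_mul (le_abs_self c) ho ho0 (abs_nonneg c)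
      nlinarith
    · have hnot : ¬ conc star ξ ≤ c * ‖Star.star φ ⬝ᵥ ξ‖ ^ 2 := fun h =>
        hξ ⟨isWClass_iff.mpr ⟨hW, h1⟩, h⟩
      have := mul_nonneg hk0 (sub_nonneg.mpr ho)
      nlinarith
  refine ⟨k, fun ξ hW => ?_⟩
  rcases (sqNorm_nonneg ξ).eq_or_lt with h0 | hpos
  · have : ξ = 0 := sqNorm_eq_zero h0.symm
    subst this
    have := conc_nonneg star (0 : Bits → ℂ)
    simpa [sqNorm] using this
  · have hr := Real.sqrt_pos.mpr hpos
    have hr2 := Real.sq_sqrt hpos.le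
    set r := √(sqNorm ξ)
    have hn : ‖((r⁻¹ : ℝ) : ℂ)‖ ^ 2 = (sqNorm ξ)⁻¹ := by
      rw [Complex.norm_real, Real.norm_eq_abs, sq_abs, inv_pow, hr2]
    have h := hunit (((r⁻¹ : ℝ) : ℂ) • ξ) (hW.smul _) (by
      rw [sqNorm_smul, hn, inv_mul_cancel₀ hpos.ne'])
    rw [dotProduct_smul, norm_smul, mul_pow, sqNorm_smul, conc_smul, hn] at h
    have h' := mul_le_mul_of_nonneg_left h hpos.le
    have e1 : sqNorm ξ * ((c + k) * ((sqNorm ξ)⁻¹ * ‖Star.star φ ⬝ᵥ ξ‖ ^ 2)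
        - k * ((sqNorm ξ)⁻¹ * sqNorm ξ))
        = (c + k) * ‖Star.star φ ⬝ᵥ ξ‖ ^ 2 - k * sqNorm ξ := by field_simp
    have e2 : sqNorm ξ * ((sqNorm ξ)⁻¹ * conc star ξ) = conc star ξ := by field_simp
    rwa [e1, e2] at h'

/-- The functional `ρ ↦ (c + k)⟨φ|ρ|φ⟩ - k tr ρ`. -/
def supportFunctional (φ : Bits → ℂ) (c k : ℝ) : Matrix Bits Bits ℂ →ₗ[ℝ] ℝ where
  toFun ρ := (c + k) * (star φ ⬝ᵥ ρ.mulVec φ).re - k * ρ.trace.re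
  map_add' a b := by
    simp only [Matrix.add_mulVec, dotProduct_add, Matrix.trace_add, Complex.add_re]; ring
  map_smul' r a := by
    simp only [Matrix.smul_mulVec, dotProduct_smul, Matrix.trace_smul, Complex.real_smul,
      Complex.re_ofReal_mul, smul_eq_mul, RingHom.id_apply]; ring

theorem supportFunctional_ketbra (φ ξ : Bits → ℂ) (c k : ℝ) :
    supportFunctional φ c k (ketbra ξ) = (c + k) * ‖star φ ⬝ᵥ ξ‖ ^ 2 - k * sqNorm ξ := by
  have h : star φ ⬝ᵥ (ketbra ξ).mulVec φ = ((‖star φ ⬝ᵥ ξ‖ ^ 2 : ℝ) : ℂ) := by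
    rw [ketbra, Matrix.vecMulVec_mulVec, dotProduct_smul]
    have h2 : star ξ ⬝ᵥ φ = star (star φ ⬝ᵥ ξ) := by
      rw [Matrix.star_dotProduct]
    rw [h2, op_smul_eq_mul, mul_comm]
    push_cast
    exact Complex.conj_mul' _
  change (c + k) * (star φ ⬝ᵥ (ketbra ξ).mulVec φ).re - k * (ketbra ξ).trace.re = _
  rw [h, ketbra, trace_vecMulVec_star, Complex.ofReal_re, Complex.ofReal_re]

theorem exists_isFeasible_support (star : Fin 3) {φ : Bits → ℂ} (hφ : sqNorm φ = 1) {c : ℝ}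
    (hc : IsWCone φ → c < conc star φ) : ∃ ℓ, IsFeasible star ℓ ∧
      ∀ p : ℝ, ℓ ((p : ℂ) • ketbra φ) = p * c := by
  obtain ⟨k, hk⟩ := exists_support star hφ hc
  refine ⟨supportFunctional φ c k, fun ξ hξ => ?_, fun p => ?_⟩
  · rw [supportFunctional_ketbra]
    exact hk ξ hξ
  · rw [Complex.coe_smul, map_smul, supportFunctional_ketbra, star_dotProduct_self, hφ]
    simp

theorem IsMonotoneFamily.average_le {star : Fin 3} {Θ : Type} {E : OpFamily Bits Θ}
    (hE : IsMonotoneFamily star E) {ψ : Bits → ℂ} (hψ : IsWCone ψ) {p : Θ → ℝ}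
    {φ : Θ → Bits → ℂ} (hy : YieldsPure E ψ p φ) :
    (∀ j, p j ≠ 0 → IsWCone (φ j)) ∧
      ∀ s : Finset Θ, ∑ j ∈ s, p j * conc star (φ j) ≤ conc star ψ := by
  rw [isMonotoneFamily_iff] at hE
  have hp := fun j => (hy j).1
  have hW : ∀ j, p j ≠ 0 → IsWCone (φ j) := by
    intro j hj
    by_contra hn
    have hpos : 0 < p j := lt_of_le_of_ne (hp j) hj.symm
    -- This constant gives the functional the value `conc star ψ + 1` at the unnormalized output,
    -- contradicting monotonicity.
    obtain ⟨ℓ, hℓ, hval⟩ := exists_isFeasible_support star (hy j).2.1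
      (c := (conc star ψ + 1) / p j) fun h => absurd h hn
    have := hE {j} (fun _ => ℓ) (fun _ => hℓ) ψ hψ
    rw [Finset.sum_singleton, (hy j).2.2, hval, mul_div_cancel₀ _ hj] at this
    linarith
  refine ⟨hW, fun s => ?_⟩
  refine le_of_forall_pos_le_add fun ε hε => ?_
  have hP : 0 ≤ ∑ j ∈ s, p j := Finset.sum_nonneg fun j _ => hp j
  -- The supporting functionals reach only values strictly below `conc`; with this margin the total
  -- loss over `s` is at most ε.
  set δ := ε / (1 + ∑ j ∈ s, p j)
  have hδ : 0 < δ := by positivity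
  have hex : ∀ j, ∃ ℓ, IsFeasible star ℓ ∧
      ℓ ((p j : ℂ) • ketbra (φ j)) = p j * (conc star (φ j) - δ) := by
    intro j
    obtain ⟨ℓ, h1, h2⟩ := exists_isFeasible_support star (hy j).2.1
      (c := conc star (φ j) - δ) fun _ => sub_lt_self _ hδ
    exact ⟨ℓ, h1, h2 _⟩
  choose ℓ hℓ hval using hex
  have := hE s ℓ hℓ ψ hψ
  simp only [(hy _).2.2, hval, mul_sub, Finset.sum_sub_distrib, ← Finset.sum_mul] at this
  have hle : (∑ j ∈ s, p j) * δ ≤ ε := by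
    have e : (1 + ∑ j ∈ s, p j) * δ = ε := mul_div_cancel₀ _ (by positivity)
    linarith
  linarith

theorem locc_average_le (star : Fin 3) {ψ : Bits → ℂ} {x : Fin 3 → ℝ} (hx : HasWParams ψ x)
    {Θ : Type} {E : OpFamily Bits Θ} (hE : IsLOCC E) {p : Θ → ℝ} {φ : Θ → Bits → ℂ}
    (hy : YieldsPure E ψ p φ) :
    (∀ j, p j ≠ 0 → IsWClass (φ j)) ∧
      ∀ y : Θ → Fin 3 → ℝ, (∀ j, p j ≠ 0 → HasWParams (φ j) (y j)) →
        Summable (fun j => p j * concFun star (y j)) ∧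
          ∑' j, p j * concFun star (y j) ≤ concFun star x := by
  obtain ⟨hW, hs⟩ := (hE.isMonotoneFamily star).average_le hx.isWCone hy
  refine ⟨fun j hj => (hW j hj).isWClass (hy j).2.1, fun y hy' => ?_⟩
  have e : (fun j => p j * concFun star (y j)) = fun j => p j * conc star (φ j) := by
    ext1 j
    by_cases hj : p j = 0
    · simp [hj]
    · rw [(hy' j hj).concFun_eq]
  rw [e, hx.concFun_eq]
  have h0 : ∀ j, 0 ≤ p j * conc star (φ j) := fun j => mul_nonneg (hy j).1 (conc_nonneg _ _)
  have hsum := summable_of_sum_le h0 hs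
  exact ⟨hsum, hsum.tsum_le_of_sum_le hs⟩

end

theorem mainTheorem4 (star : Fin 3) (ψ : Bits → ℂ) (x : Fin 3 → ℝ) (hx : HasWParams ψ x) :
    -- `𝒞` is non-increasing on average under LOCC
    (∀ (Θ : Type) [Countable Θ] (E : OpFamily Bits Θ), IsLOCC E →
      ∀ (p : Θ → ℝ) (φ : Θ → Bits → ℂ), YieldsPure E ψ p φ →
        (∀ j, p j ≠ 0 → IsWClass (φ j)) ∧
        ∀ y : Θ → Fin 3 → ℝ, (∀ j, p j ≠ 0 → HasWParams (φ j) (y j)) →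
          Summable (fun j => p j * concFun star (y j)) ∧
          ∑' j, p j * concFun star (y j) ≤ concFun star x) ∧
    -- strict decrease when `⋆` or `n₁` performs a non-trivial measurement
    (0 < concFun star x →
      ∀ K : Fin 3, K = star ∨ IsFirstParty star x K →
      ∀ (Θ : Type) [Countable Θ] (M : Θ → Matrix (Fin 2) (Fin 2) ℂ),
        IsMeasurement M → ¬ IsTrivialMeasurement M →
      ∀ (p : Θ → ℝ) (φ : Θ → Bits → ℂ), YieldsPure (localMeasurement K M) ψ p φ →
        (∀ j, p j ≠ 0 → IsWClass (φ j)) ∧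
        ∀ y : Θ → Fin 3 → ℝ, (∀ j, p j ≠ 0 → HasWParams (φ j) (y j)) →
          Summable (fun j => p j * concFun star (y j)) ∧
          ∑' j, p j * concFun star (y j) < concFun star x) := by
  refine ⟨fun Θ _ E hE p φ hy => locc_average_le star hx hE hy, ?_⟩
  intro hpos K hK Θ _ M hM hnt p φ hy
  exact measurement_decrease star hx hpos hK hM hnt hy
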